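/- Let $G=(V,E)$ be a finite directed graph without self-loops and without multiple edges (for each ordered pair $(u,v)$ there is at most one edge from $u$ to $v$; both $(u,v)$ and $(v,u)$ may be edges), with $n$ vertices and $m$ edges. Let $a(G)$ be the arboricity of the underlying undirected graph, i.e. the minimum number of edge-disjoint spanning forests into which it can be decomposed. For a field $\mathbb{F}$ let $\Lambda_d$ be the $\mathbb{F}$-vector space with basis the elementary $d$-paths $e_{i_0\cdots i_d}$, $i_0,\dots,i_d\in V$, let $\partial e_{i_0\cdots i_d}=\sum_j(-1)^j e_{i_0\cdots\hat{\imath}_j\cdots i_d}$, where terms with two equal consecutive vertices are replaced by $0$, let $\mathcal{A}_d$ be the span of the $e_{i_0\cdots i_d}$ with $(i_k,i_{k+1})\in E$ for all $k$, and put $\Omega_2=\{p\in\mathcal{A}_2:\partial p\in\mathcal{A}_1\}$. The first path-homology boundary group is $\mathsf{B}_1=\partial\,\Omega_2$. A bigon of $G$ is a chain $e_{uv}+e_{vu}$ with $(u,v),(v,u)\in E$; a boundary triangle is a chain $e_{vw}-e_{uw}+e_{uv}$ with $(u,v),(v,w),(u,w)\in E$; a boundary quadrangle is a chain $e_{uv}+e_{vw}-e_{uz}-e_{zw}$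 with $(u,v),(v,w),(u,z),(z,w)\in E$ and $u\ne w$, $v\ne z$. Then there is an algorithm, independent of the field, for a unit-cost random access machine with words of $O(\log(n+m))$ bits that, given $n$, $m$ and a list of the edges of $G$, runs in $O(a(G)\,m)$ time ($O(1)$ time if $m=0$) and outputs a list of $O(a(G)\,m)$ cycles, each written as the list of its vertices, that consists of all bigons of $G$, all boundary triangles of $G$ and some boundary quadrangles of $G$, and that generates $\mathsf{B}_1$ over every field $\mathbb{F}$. The constants in the bounds are absolute. -/

import Mathlib

/-! ## Regular path chains of a directed graph -/

namespace PathHomology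

variable {V : Type*}

/-- The elementary path `e_{p 0, ..., p d}` is regular: no two consecutive vertices coincide. -/
def IsRegularPath {d : ℕ} (p : Fin (d + 1) → V) : Prop :=
  ∀ i : Fin d, p i.castSucc ≠ p i.succ

/-- The elementary path `e_{p 0, ..., p d}` is allowed: consecutive vertices are joined by
directed edges. -/
def IsAllowedPath (G : Digraph V) {d : ℕ} (p : Fin (d + 1) → V) : Prop :=
  ∀ i : Fin d, G.Adj (p i.castSucc) (p i.succ)

/-- `Λ_d`: all linear combinations of elementary `d`-paths on `V`. -/
abbrev Chain (F V : Type*) [Field F] (d : ℕ) : Type _ := (Fin (d + 1) → V) →₀ F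

open Classical in
/-- The boundary `∂ e_{i_0, ..., i_{d+1}} = ∑_j (-1)^j e_{i_0, ..., î_j, ..., i_{d+1}}`, where the
terms with consecutive repeated vertices are replaced by `0`. -/
noncomputable def boundary (F V : Type*) [Field F] (d : ℕ) :
    Chain F V (d + 1) →ₗ[F] Chain F V d :=
  Finsupp.linearCombination F fun p : Fin (d + 2) → V =>
    ∑ j : Fin (d + 2),
      if IsRegularPath (fun i : Fin (d + 1) => p (j.succAbove i)) then
        Finsupp.single (fun i : Fin (d + 1) => p (j.succAbove i)) ((-1 : F) ^ (j : ℕ))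
      else 0

/-- `A_d`: the span of the allowed elementary `d`-paths. -/
noncomputable def allowedChains (F : Type*) [Field F] (G : Digraph V) (d : ℕ) :
    Submodule F (Chain F V d) :=
  Submodule.span F {x | ∃ p : Fin (d + 1) → V, IsAllowedPath G p ∧ x = Finsupp.single p 1}

/-- `Ω_{d+1}`: the allowed `(d+1)`-paths whose boundary is allowed. -/
noncomputable def invariantChains (F : Type*) [Field F] (G : Digraph V) (d : ℕ) :
    Submodule F (Chain F V (d + 1)) :=
  allowedChains F G (d + 1) ⊓ (allowedChains F G d).comap (boundary F V d)

/-- The boundary group `B_d = ∂ Ω_{d+1}`. -/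
noncomputable def boundaryGroup (F : Type*) [Field F] (G : Digraph V) (d : ℕ) :
    Submodule F (Chain F V d) :=
  (invariantChains F G d).map (boundary F V d)

/-- The elementary `1`-path `e_{uv}`. -/
noncomputable def edgeChain (F : Type*) [Field F] (u v : V) : Chain F V 1 :=
  Finsupp.single ![u, v] 1

/-- Names for the three kinds of small boundary cycles. -/
inductive SmallCycle (V : Type*) where
  /-- The bigon on the vertices `u` and `v`. -/
  | bigon (u v : V)
  /-- The triangle `(u, w | v)` with source `u`, sink `w` and middle vertex `v`. -/
  | triangle (u w v : V)
  /-- The quadrangle `{u, w | v, z}` with source `u`, sink `w` and middle vertices `v`, `z`. -/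
  | quadrangle (u w v z : V)

namespace SmallCycle

/-- The cycle is a bigon, a boundary triangle or a boundary quadrangle of `G`
(for a graph without self-loops, its two, three or four vertices are then distinct). -/
def OccursIn (G : Digraph V) : SmallCycle V → Prop
  | bigon u v => G.Adj u v ∧ G.Adj v u
  | triangle u w v => G.Adj u v ∧ G.Adj v w ∧ G.Adj u w
  | quadrangle u w v z =>
      G.Adj u v ∧ G.Adj v w ∧ G.Adj u z ∧ G.Adj z w ∧ u ≠ w ∧ v ≠ z

/-- The `1`-chain that the cycle stands for. -/
noncomputable def toChain (F : Type*) [Field F] : SmallCycle V → Chain F V 1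
  | bigon u v => edgeChain F u v + edgeChain F v u
  | triangle u w v => edgeChain F v w - edgeChain F u w + edgeChain F u v
  | quadrangle u w v z =>
      edgeChain F u v + edgeChain F v w - edgeChain F u z - edgeChain F z w

/-- The words by which a machine writes the cycle down: the number of its vertices, then the
vertices. This is a prefix code, so a concatenation of such words determines the cycles. -/
def encode {n : ℕ} : SmallCycle (Fin n) → List ℕ
  | bigon u v => [2, u, v]
  | triangle u w v => [3, u, w, v]
  | quadrangle u w v z => [4, u, w, v, z]

end SmallCycle

end PathHomology

/-! ## Arboricity -/

/-- The arboricity of a graph: the least number of edge-disjoint spanning forests into which the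
graph can be decomposed. -/
noncomputable def SimpleGraph.arboricity {V : Type*} (H : SimpleGraph V) : ℕ :=
  sInf {k : ℕ | ∃ T : Fin k → SimpleGraph V,
    (∀ i, (T i).IsAcyclic) ∧
    (∀ i j, i ≠ j → Disjoint (T i).edgeSet (T j).edgeSet) ∧
    (⋃ i, (T i).edgeSet) = H.edgeSet}

/-! ## A random access machine with unit-cost instructions on bounded words -/

namespace RAM

/-- A memory state: registers, arrays (a program mentions only finitely many registers and arrays),
and the words written to the output so far. -/
structure State where
  reg : ℕ → ℕ
  arr : ℕ → ℕ → ℕ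
  out : List ℕ

/-- Elementary instructions. Registers and arrays are named by natural numbers. -/
inductive Instr where
  /-- `r := k` -/
  | const (r k : ℕ)
  /-- `r := s` -/
  | move (r s : ℕ)
  /-- `r := s + t` -/
  | add (r s t : ℕ)
  /-- `r := s - t`, truncated at `0` -/
  | sub (r s t : ℕ)
  /-- `r := a[s]` -/
  | load (r a s : ℕ)
  /-- `a[s] := t` -/
  | store (a s t : ℕ)
  /-- append the content of `r` to the output -/
  | emit (r : ℕ)

/-- Tests compare two registers. -/
inductive Test where
  | lt (r s : ℕ)
  | eq (r s : ℕ)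

/-- Programs. -/
inductive Prog where
  | skip
  | instr (i : Instr)
  | seq (p q : Prog)
  | ite (b : Test) (p q : Prog)
  | loop (b : Test) (p : Prog)

/-- The word which an instruction writes. -/
def Instr.value (σ : State) : Instr → ℕ
  | const _ k => k
  | move _ s => σ.reg s
  | add _ s t => σ.reg s + σ.reg t
  | sub _ s t => σ.reg s - σ.reg t
  | load _ a s => σ.arr a (σ.reg s)
  | store _ _ t => σ.reg t
  | emit r => σ.reg r

/-- The state after an instruction. -/
def Instr.next (σ : State) (i : Instr) : State :=
  match i with
  | const r _ | move r _ | add r _ _ | sub r _ _ | load r _ _ =>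
      { σ with reg := Function.update σ.reg r (i.value σ) }
  | store a s _ =>
      { σ with
        arr := Function.update σ.arr a
          (Function.update (σ.arr a) (σ.reg s) (i.value σ)) }
  | emit _ => { σ with out := σ.out ++ [i.value σ] }

/-- The truth of a test. -/
def Test.Holds (σ : State) : Test → Prop
  | lt r s => σ.reg r < σ.reg s
  | eq r s => σ.reg r = σ.reg s

/-- `Exec W p σ σ' t`: on a machine whose words are the numbers below `W`, the program `p` started
in `σ` halts in `σ'` after exactly `t` steps; every instruction and every evaluation of a test is
one step. An instruction whose result is not a word has no execution. -/
inductive Exec (W : ℕ) : Prog → State → State → ℕ → Prop where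
  | skip (σ : State) : Exec W .skip σ σ 1
  | instr (i : Instr) (σ : State) (h : i.value σ < W) : Exec W (.instr i) σ (i.next σ) 1
  | seq {p q : Prog} {σ σ' σ'' : State} {t t' : ℕ}
      (h : Exec W p σ σ' t) (h' : Exec W q σ' σ'' t') : Exec W (.seq p q) σ σ'' (t + t')
  | ite_pos {b : Test} {p q : Prog} {σ σ' : State} {t : ℕ}
      (hb : b.Holds σ) (h : Exec W p σ σ' t) : Exec W (.ite b p q) σ σ' (t + 1)
  | ite_neg {b : Test} {p q : Prog} {σ σ' : State} {t : ℕ}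
      (hb : ¬ b.Holds σ) (h : Exec W q σ σ' t) : Exec W (.ite b p q) σ σ' (t + 1)
  | loop_stop {b : Test} {p : Prog} {σ : State}
      (hb : ¬ b.Holds σ) : Exec W (.loop b p) σ σ 1
  | loop_step {b : Test} {p : Prog} {σ σ' σ'' : State} {t t' : ℕ}
      (hb : b.Holds σ) (h : Exec W p σ σ' t) (h' : Exec W (.loop b p) σ' σ'' t') :
      Exec W (.loop b p) σ σ'' (t + t' + 1)

/-- The initial state for a list of `m` directed edges on the vertices `0, ..., n - 1`: registers
`0` and `1` hold `n` and `m`, cell `i` of array `0` (of array `1`) holds the tail (the head) of the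
`i`-th edge; everything else is `0` and the output is empty. -/
def edgeListState {n : ℕ} (es : List (Fin n × Fin n)) : State where
  reg r := if r = 0 then n else if r = 1 then es.length else 0
  arr a i :=
    if a = 0 then (es.map fun e => (e.1 : ℕ)).getD i 0
    else if a = 1 then (es.map fun e => (e.2 : ℕ)).getD i 0
    else 0
  out := []

end RAM

/-! Algebra. In the quotient of the 1-chains by the span of all small cycles, the boundary of an
allowed path $e_{uvw}$ depends only on $(u,w)$, and it vanishes if $u=w$ or $(u,w)$ is an edge. A
linear map on 1-chains can therefore reproduce these classes from the unwanted faces $e_{uw}$ alone.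
It kills allowed chains, so $\partial x$ has class zero for $x\in\Omega_2$ (`boundaryGroup_one_le`).
Hence bigons, triangles and quadrangles generate.

Fewer quadrangles suffice. Those with given ends $u,w$ are differences of quadrangles through one
fixed middle vertex. Those with given middle vertices $v,z$ are indexed by pairs (common
in-neighbour, common out-neighbour), and a fixed row and a fixed column of this grid generate all of
them. `span_eq_boundaryGroup` uses these relations after sorting each quadrangle by where a vertex
of large degree lies. Their coefficients are $\pm1$, so one list serves every field.

Counting. Around each $v$ one only follows wedges $v,u,w$ with $\deg u\le\deg v$. Their number is
controlled by $\sum\min(\deg u,\deg v)$ over the edges. In a decomposition into $a(G)$ forests every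
edge joins a vertex to its parent in one forest, and charging the minimum to the child bounds the
sum by $O(a(G)\,m)$ (`Digraph.sum_min_le_arboricity`, `sum_wedgeCost_le`).

Machine. A table indexed by vertices, reset only at the ends of the current wedges, supplies the
representative in constant time per wedge (`Lists.lookup`). Vertices are reached through the edge
list, so isolated ones cost nothing. The list is no longer than the running time. -/

namespace RAM

/-! ### Invariants of executions: word bounds and frame conditions -/

variable {W : ℕ}

/-- Every register and every array cell holds a word. -/
def State.Bounded (W : ℕ) (σ : State) : Prop :=
  (∀ r, σ.reg r < W) ∧ ∀ a i, σ.arr a i < W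

/-- An instruction runs only if its value is a word. Hence from a bounded state, loads, moves and
emits never need a check, and only constants and additions do. -/
theorem Exec.bounded {p : Prog} {σ σ' : State} {t : ℕ} (h : Exec W p σ σ' t)
    (hσ : σ.Bounded W) : σ'.Bounded W := by
  induction h with
  | skip => exact hσ
  | instr i σ h =>
    obtain ⟨h1, h2⟩ := hσ
    cases i with
    | store a s t =>
      refine ⟨h1, fun b j => ?_⟩
      simp only [Instr.next, Function.update_apply]
      split_ifs
      · simp only [Function.update_apply]; split_ifs
        · exact h
        · exact h2 _ _
      · exact h2 _ _
    | emit r => exact ⟨h1, h2⟩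
    | _ =>
      refine ⟨fun b => ?_, h2⟩
      simp only [Instr.next, Function.update_apply]
      split_ifs
      · exact h
      · exact h1 _
  | seq _ _ ih1 ih2 => exact ih2 (ih1 hσ)
  | ite_pos _ _ ih => exact ih hσ
  | ite_neg _ _ ih => exact ih hσ
  | loop_stop => exact hσ
  | loop_step _ _ _ ih1 ih2 => exact ih2 (ih1 hσ)

/-- One step emits at most one word; this turns the time bound into the bound on the number of
cycles. -/
theorem Exec.length_out_le {p : Prog} {σ σ' : State} {t : ℕ} (h : Exec W p σ σ' t) :
    σ'.out.length ≤ σ.out.length + t := by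
  induction h with
  | instr i σ h => cases i <;> simp [Instr.next]
  | _ => omega

/-- The two states have the same registers below `k` and the same arrays below `10`. -/
structure State.Agree (k : ℕ) (σ σ' : State) : Prop where
  reg : ∀ r < k, σ'.reg r = σ.reg r
  arr : ∀ a < 10, σ'.arr a = σ.arr a

theorem State.Agree.refl (k : ℕ) (σ : State) : σ.Agree k σ := ⟨fun _ _ => rfl, fun _ _ => rfl⟩

theorem State.Agree.trans {k : ℕ} {σ σ' σ'' : State} (h : σ.Agree k σ') (h' : σ'.Agree k σ'') :
    σ.Agree k σ'' :=
  ⟨fun r hr => (h'.reg r hr).trans (h.reg r hr), fun r hr => (h'.arr r hr).trans (h.arr r hr)⟩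

theorem State.Agree.mono {k l : ℕ} {σ σ' : State} (h : σ.Agree k σ') (hl : l ≤ k) :
    σ.Agree l σ' :=
  ⟨fun r hr => h.reg r (hr.trans_le hl), h.arr⟩

/-- The instruction writes only to registers from `k` on and to arrays from `10` on. -/
def Instr.Avoids (k : ℕ) : Instr → Prop
  | const r _ | move r _ | add r _ _ | sub r _ _ | load r _ _ => k ≤ r
  | store a _ _ => 10 ≤ a
  | emit _ => True

/-- The program writes only to registers from `k` on and to arrays from `10` on. -/
def Prog.Avoids (k : ℕ) : Prog → Prop
  | skip => True
  | instr i => i.Avoids k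
  | seq p q => p.Avoids k ∧ q.Avoids k
  | ite _ p q => p.Avoids k ∧ q.Avoids k
  | loop _ p => p.Avoids k

theorem Instr.Avoids.mono {k l : ℕ} (hl : l ≤ k) {i : Instr} (h : i.Avoids k) : i.Avoids l := by
  cases i <;> simp only [Instr.Avoids] at * <;> omega

theorem Prog.Avoids.mono {k l : ℕ} (hl : l ≤ k) {p : Prog} (h : p.Avoids k) : p.Avoids l := by
  induction p with
  | skip => trivial
  | instr i => exact Instr.Avoids.mono hl h
  | seq p q ihp ihq => exact ⟨ihp h.1, ihq h.2⟩
  | ite b p q ihp ihq => exact ⟨ihp h.1, ihq h.2⟩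
  | loop b p ih => exact ih h

/-- The frame rule for nested loops: inner programs use only higher registers, and the input and
adjacency data lie in arrays below `10`, so a syntactic check preserves the state of every outer
loop. -/
theorem Exec.agree {p : Prog} {σ σ' : State} {t k : ℕ} (h : Exec W p σ σ' t) (hp : p.Avoids k) :
    σ.Agree k σ' := by
  induction h with
  | skip => exact .refl _ _
  | instr i σ h =>
    cases i with
    | store a s t =>
      refine ⟨fun _ _ => rfl, fun b hb => ?_⟩
      have : 10 ≤ a := hp
      simp only [Instr.next]
      rw [Function.update_of_ne (by omega)]
    | emit r => exact ⟨fun _ _ => rfl, fun _ _ => rfl⟩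
    | _ =>
      refine ⟨fun b hb => ?_, fun _ _ => rfl⟩
      have : k ≤ _ := hp
      simp only [Instr.next]
      rw [Function.update_of_ne (by omega)]
  | seq _ _ ih1 ih2 => exact (ih1 hp.1).trans (ih2 hp.2)
  | ite_pos _ _ ih => exact ih hp.1
  | ite_neg _ _ ih => exact ih hp.2
  | loop_stop => exact .refl _ _
  | loop_step _ _ _ ih1 ih2 => exact (ih1 hp).trans (ih2 hp)

/-! ### Rules for total correctness with time bounds -/

/-- Started in `σ`, the program halts after at most `T` steps in a state that satisfies `Q`. -/
def Runs (W : ℕ) (p : Prog) (T : ℕ) (σ : State) (Q : State → Prop) : Prop :=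
  ∃ σ' t, Exec W p σ σ' t ∧ t ≤ T ∧ Q σ'

namespace Runs

variable {p q : Prog} {σ : State} {T T' : ℕ} {Q Q' : State → Prop}

theorem mono (h : Runs W p T σ Q) (hT : T ≤ T') (hQ : ∀ σ', Q σ' → Q' σ') :
    Runs W p T' σ Q' := by
  obtain ⟨σ', t, h, ht, hq⟩ := h
  exact ⟨σ', t, h, ht.trans hT, hQ _ hq⟩

theorem bounded (hσ : σ.Bounded W) (h : Runs W p T σ Q) :
    Runs W p T σ fun σ' => σ'.Bounded W ∧ Q σ' := by
  obtain ⟨σ', t, h, ht, hq⟩ := h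
  exact ⟨σ', t, h, ht, h.bounded hσ, hq⟩

theorem agree {k : ℕ} (hp : p.Avoids k) (h : Runs W p T σ Q) :
    Runs W p T σ fun σ' => σ.Agree k σ' ∧ Q σ' := by
  obtain ⟨σ', t, h, ht, hq⟩ := h
  exact ⟨σ', t, h, ht, h.agree hp, hq⟩

theorem skip (h : Q σ) : Runs W .skip 1 σ Q := ⟨σ, 1, .skip σ, le_rfl, h⟩

theorem instr (i : Instr) (hv : i.value σ < W) (h : Q (i.next σ)) : Runs W (.instr i) 1 σ Q :=
  ⟨_, 1, .instr i σ hv, le_rfl, h⟩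

theorem seq (h : Runs W p T σ fun σ' => Runs W q T' σ' Q) : Runs W (.seq p q) (T + T') σ Q := by
  obtain ⟨σ', t, h, ht, σ'', t', h', ht', hq⟩ := h
  exact ⟨σ'', _, .seq h h', by omega, hq⟩

theorem instr_seq (i : Instr) (hv : i.value σ < W) (h : Runs W q T (i.next σ) Q) :
    Runs W (.seq (.instr i) q) (T + 1) σ Q := by
  rw [add_comm]
  exact seq (instr i hv h)

theorem ite {b : Test} (h : b.Holds σ → Runs W p T σ Q) (h' : ¬ b.Holds σ → Runs W q T σ Q) :
    Runs W (.ite b p q) (T + 1) σ Q := by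
  by_cases hb : b.Holds σ
  · obtain ⟨σ', t, h, ht, hq⟩ := h hb
    exact ⟨σ', _, .ite_pos hb h, by omega, hq⟩
  · obtain ⟨σ', t, h, ht, hq⟩ := h' hb
    exact ⟨σ', _, .ite_neg hb h, by omega, hq⟩

theorem loop_stop {b : Test} (hb : ¬ b.Holds σ) (h : Q σ) : Runs W (.loop b p) 1 σ Q :=
  ⟨σ, 1, Exec.loop_stop hb, le_rfl, h⟩

theorem loop_step {b : Test} (hb : b.Holds σ)
    (h : Runs W p T σ fun σ' => Runs W (.loop b p) T' σ' Q) :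
    Runs W (.loop b p) (T + T' + 1) σ Q := by
  obtain ⟨σ', t, h, ht, σ'', t', h', ht', hq⟩ := h
  exact ⟨σ'', _, .loop_step hb h h', by omega, hq⟩

/-- A counting loop. -/
theorem for_loop {b : Test} {m : ℕ} (I : ℕ → State → Prop) (cost : ℕ → ℕ)
    (hb : ∀ i σ, i ≤ m → I i σ → (b.Holds σ ↔ i < m))
    (step : ∀ i σ, i < m → I i σ → Runs W p (cost i) σ (I (i + 1))) (h0 : I 0 σ) :
    Runs W (.loop b p) (1 + ∑ i ∈ Finset.range m, (cost i + 1)) σ (I m) := by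
  -- Induction on the number `k` of iterations still to be done.
  suffices ∀ k ≤ m, ∀ σ, I (m - k) σ →
      Runs W (.loop b p) (1 + ∑ i ∈ Finset.Ico (m - k) m, (cost i + 1)) σ (I m) by
    have := this m le_rfl σ (by simpa using h0)
    rwa [Nat.sub_self, ← Finset.range_eq_Ico] at this
  intro k
  induction k with
  | zero =>
    intro _ σ h
    simp only [Nat.sub_zero] at h
    exact (loop_stop (by rw [hb m σ le_rfl h]; omega) h).mono (by omega) fun _ h => h
  | succ k ih =>
    intro hk σ h
    refine (loop_step (T' := 1 + ∑ i ∈ Finset.Ico (m - k) m, (cost i + 1))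
      ((hb _ σ (by omega) h).2 (by omega)) ((step _ σ (by omega) h).mono le_rfl ?_)).mono
      ?_ fun _ h => h
    · intro σ' h'
      rw [show m - (k + 1) + 1 = m - k by omega] at h'
      exact ih (by omega) σ' h'
    · rw [Finset.sum_eq_sum_Ico_succ_bot (show m - (k + 1) < m by omega),
        show m - (k + 1) + 1 = m - k by omega]
      omega

end Runs

/-! ### Linked lists of vertices -/

/-- The pointer `p` is the start of a linked list with the contents `l`; the null pointer is `0`. -/
def Linked {n : ℕ} (nxt dst : ℕ → ℕ) : ℕ → List (Fin n) → Prop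
  | p, [] => p = 0
  | p, x :: l => 0 < p ∧ dst p = x ∧ Linked nxt dst (nxt p) l

/-- Run `body` for all entries of the linked list that starts at register `p`, with the entry in
register `p + 1`. The arrays `A` and `D` hold the links and the entries. -/
def walk (A D p : ℕ) (body : Prog) : Prog :=
  .loop (.lt 2 p)
    (.seq (.instr (.load (p + 1) D p)) (.seq (.instr (.load p A p)) body))

theorem Runs.walk {n A D p : ℕ} {body : Prog} (hA : A < 10) (hD : D < 10) (hp : 2 < p)
    (hbody : body.Avoids (p + 2)) {σ₀ : State} (hz : σ₀.reg 2 = 0)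
    (I : List (Fin n) → (ℕ → ℕ → ℕ) → List ℕ → Prop) (cost : Fin n → ℕ) (l : List (Fin n))
    (step : ∀ (done : List (Fin n)) (x : Fin n) (rest : List (Fin n)), done ++ x :: rest = l → ∀ σ, σ₀.Agree p σ → σ.Bounded W →
      σ.reg (p + 1) = x → I done σ.arr σ.out →
        Runs W body (cost x) σ fun σ' => I (done ++ [x]) σ'.arr σ'.out)
    (hσ : σ₀.Bounded W) (h0 : I [] σ₀.arr σ₀.out)
    (hl : Linked (σ₀.arr A) (σ₀.arr D) (σ₀.reg p) l) :
    Runs W (walk A D p body) (1 + (l.map fun x => cost x + 3).sum) σ₀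
      fun σ' => I l σ'.arr σ'.out := by
  -- The list can be read in the initial arrays throughout, because the body leaves arrays below
  -- `10` alone; only the pointer moves.
  suffices ∀ rest done : List (Fin n), done ++ rest = l → ∀ σ, σ₀.Agree p σ → σ.Bounded W →
      I done σ.arr σ.out → Linked (σ₀.arr A) (σ₀.arr D) (σ.reg p) rest →
      Runs W (RAM.walk A D p body) (1 + (rest.map fun x => cost x + 3).sum) σ
        fun σ' => I l σ'.arr σ'.out from
    this l [] rfl σ₀ (.refl _ _) hσ h0 hl
  intro rest
  induction rest with
  | nil =>
    intro done hd σ hag hb hI hk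
    have hk : σ.reg p = 0 := hk
    rw [List.append_nil] at hd
    subst hd
    refine (Runs.loop_stop ?_ hI).mono (by omega) fun _ h => h
    simp [Test.Holds, hk]
  | cons x rest ih =>
    intro done hd σ hag hb hI hk
    obtain ⟨hk1, hk2, hk3⟩ := hk
    have hz' : σ.reg 2 = 0 := by rw [hag.reg 2 hp, hz]
    refine (Runs.loop_step (T := cost x + 1 + 1)
      (T' := 1 + (rest.map fun x => cost x + 3).sum) (by simp [Test.Holds, hz', hk1])
      (Runs.instr_seq _ (hb.2 _ _) (Runs.instr_seq _ ?_ ?_))).mono ?_ fun _ h => h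
    · exact hb.2 _ _
    · set τ := Instr.next (Instr.next σ (.load (p + 1) D p)) (.load p A p) with hτ
      have hτx : τ.reg (p + 1) = x := by
        simp [hτ, Instr.next, Instr.value, ← hk2, hag.arr D hD]
      have hτp : τ.reg p = σ₀.arr A (σ.reg p) := by
        simp [hτ, Instr.next, Instr.value, hag.arr A hA]
      have hτa : τ.arr = σ.arr := rfl
      have hτo : τ.out = σ.out := rfl
      have hστ : σ.Agree p τ := by
        refine ⟨fun r hr => ?_, fun _ _ => rfl⟩
        simp only [hτ, Instr.next]
        rw [Function.update_of_ne (by omega), Function.update_of_ne (by omega)]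
      have hτb : τ.Bounded W := by
        refine ⟨fun r => ?_, hb.2⟩
        simp only [hτ, Instr.next, Function.update_apply, Instr.value]
        split_ifs <;> first | exact hb.2 _ _ | exact hb.1 _
      have := ((step done x rest hd τ (hag.trans hστ) hτb hτx
        (by rw [hτa, hτo]; exact hI)).bounded hτb).agree hbody
      refine this.mono le_rfl ?_
      rintro σ' ⟨h1, h2, h3⟩
      refine ih (done ++ [x]) (by simp [hd]) σ' ((hag.trans hστ).trans (h1.mono (by omega))) h2 h3 ?_
      rw [h1.reg p (by omega), hτp]
      exact hk3
    · simp only [List.map_cons, List.sum_cons]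
      omega

end RAM

/-! ### Forests and arboricity -/

namespace SimpleGraph

variable {V : Type*}

/-- A forest has a parent function. -/
theorem IsAcyclic.exists_parent {T : SimpleGraph V} (hT : T.IsAcyclic) :
    ∃ f : V → V, ∀ u v, T.Adj u v → f u = v ∨ f v = u := by
  classical
  choose root hroot using fun c : T.ConnectedComponent => c.exists_rep
  let depth : V → ℕ := fun v => T.dist (root (T.connectedComponentMk v)) v
  -- The parent is a neighbour one step nearer the root. It is unique: each such neighbour is the
  -- penultimate vertex of a path from the root, and a forest has only one such path.
  have key : ∀ v w w', T.Adj v w → T.Adj v w' → depth v = depth w + 1 → depth v = depth w' + 1 →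
      w = w' := by
    have path : ∀ v w, T.Adj v w → depth v = depth w + 1 →
        ∃ p : T.Walk (root (T.connectedComponentMk v)) v, p.IsPath ∧ p.penultimate = w := by
      intro v w h hd
      have hc : T.connectedComponentMk w = T.connectedComponentMk v :=
        ConnectedComponent.sound h.symm.reachable
      have hr : T.Reachable (root (T.connectedComponentMk v)) w := by
        rw [← hc]
        exact ConnectedComponent.exact (hroot _)
      obtain ⟨p, hp⟩ := hr.exists_walk_length_eq_dist
      refine ⟨p.concat h.symm, ?_, by simp⟩
      apply Walk.isPath_of_length_eq_dist
      rw [Walk.length_concat, hp]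
      simp only [depth, hc] at hd
      exact hd.symm
    intro v w w' h h' hd hd'
    obtain ⟨p, hp, rfl⟩ := path v w h hd
    obtain ⟨p', hp', rfl⟩ := path v w' h' hd'
    have := congrArg Subtype.val ((hT.subsingleton_path _ _).elim ⟨p, hp⟩ ⟨p', hp'⟩)
    simp only at this
    rw [this]
  refine ⟨fun v => if h : ∃ w, T.Adj v w ∧ depth v = depth w + 1 then h.choose else v, ?_⟩
  have main : ∀ u v, T.Adj u v → depth u = depth v + 1 →
      (if h : ∃ w, T.Adj u w ∧ depth u = depth w + 1 then h.choose else u) = v := by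
    intro u v h hd
    have hex : ∃ w, T.Adj u w ∧ depth u = depth w + 1 := ⟨v, h, hd⟩
    rw [dif_pos hex]
    exact key u _ _ hex.choose_spec.1 h hex.choose_spec.2 hd
  intro u v h
  have hc : T.connectedComponentMk u = T.connectedComponentMk v :=
    ConnectedComponent.sound h.reachable
  have hr : T.Reachable (root (T.connectedComponentMk u)) u :=
    ConnectedComponent.exact (hroot _)
  rcases hT.dist_eq_dist_add_one_of_adj_of_reachable _ h hr with h1 | h1
  · left
    refine main u v h ?_
    simp only [depth, ← hc]
    exact h1
  · right
    refine main v u h.symm ?_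
    simp only [depth, ← hc]
    exact h1

theorem isAcyclic_of_edgeSet_subsingleton {T : SimpleGraph V} (h : T.edgeSet.Subsingleton) :
    T.IsAcyclic := by
  intro v p hp
  have h1 := hp.edges_nodup
  have h2 := hp.three_le_length
  rw [← Walk.length_edges] at h2
  have h3 : ∀ e ∈ p.edges, ∀ e' ∈ p.edges, e = e' := fun e he e' he' =>
    h (p.edges_subset_edgeSet he) (p.edges_subset_edgeSet he')
  match hh : p.edges with
  | [] => simp [hh] at h2
  | [_] => simp [hh] at h2
  | a :: b :: l =>
    rw [hh] at h1 h3
    simp [h3 a (by simp) b (by simp)] at h1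

/-- The infimum is attained because the set is nonempty: every single edge forms a forest by itself.
-/
theorem exists_forest_decomposition [Finite V] (H : SimpleGraph V) :
    ∃ T : Fin H.arboricity → SimpleGraph V, (∀ i, (T i).IsAcyclic) ∧
      (∀ i j, i ≠ j → Disjoint (T i).edgeSet (T j).edgeSet) ∧
      (⋃ i, (T i).edgeSet) = H.edgeSet := by
  refine Nat.sInf_mem (s := {k : ℕ | ∃ T : Fin k → SimpleGraph V,
    (∀ i, (T i).IsAcyclic) ∧
    (∀ i j, i ≠ j → Disjoint (T i).edgeSet (T j).edgeSet) ∧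
    (⋃ i, (T i).edgeSet) = H.edgeSet}) ?_
  obtain ⟨k, ⟨f⟩⟩ := Finite.exists_equiv_fin H.edgeSet
  have hE : ∀ i, (fromEdgeSet {(f.symm i : Sym2 V)}).edgeSet = {(f.symm i : Sym2 V)} := by
    intro i
    rw [edgeSet_fromEdgeSet]
    refine sdiff_eq_left.2 ?_
    rw [Set.disjoint_singleton_left, Sym2.mem_diagSet]
    exact H.not_isDiag_of_mem_edgeSet (f.symm i).2
  refine ⟨k, fun i => fromEdgeSet {(f.symm i : Sym2 V)}, fun i => ?_, fun i j hij => ?_, ?_⟩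
  · apply isAcyclic_of_edgeSet_subsingleton
    rw [hE]
    exact Set.subsingleton_singleton
  · rw [hE, hE, Set.disjoint_singleton]
    intro h
    exact hij (f.symm.injective (Subtype.ext h))
  · ext e
    simp only [hE, Set.mem_iUnion, Set.mem_singleton_iff]
    constructor
    · rintro ⟨i, rfl⟩
      exact (f.symm i).2
    · intro he
      exact ⟨f ⟨e, he⟩, by simp⟩

theorem arboricity_pos [Finite V] {H : SimpleGraph V} {u v : V} (h : H.Adj u v) :
    0 < H.arboricity := by
  obtain ⟨T, -, -, hT⟩ := H.exists_forest_decomposition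
  have : s(u, v) ∈ ⋃ i, (T i).edgeSet := hT ▸ h
  obtain ⟨i, -⟩ := Set.mem_iUnion.1 this
  exact i.pos

end SimpleGraph

/-- Over all edges of a digraph, the smaller of the weights of the two ends sum to at most twice
the arboricity times the total weight. -/
theorem Digraph.sum_min_le_arboricity {V : Type*} [Fintype V] {G : Digraph V}
    (hG : ∀ v, ¬ G.Adj v v) (E : Finset (V × V)) (hE : ∀ e ∈ E, G.Adj e.1 e.2) (d : V → ℕ) :
    ∑ e ∈ E, min (d e.1) (d e.2) ≤ 2 * G.toSimpleGraphInclusive.arboricity * ∑ v, d v := by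
  classical
  obtain ⟨T, hT, -, hTG⟩ := G.toSimpleGraphInclusive.exists_forest_decomposition
  choose f hf using fun i => (hT i).exists_parent
  -- `g` runs through all pairs of a child and its parent in each forest. The Boolean chooses the
  -- orientation, since both directions of an edge may occur in `E`; this is the factor 2. Extra
  -- values at roots only weaken the bound.
  let g : Fin G.toSimpleGraphInclusive.arboricity × Bool × V → V × V := fun x =>
    if x.2.1 then (x.2.2, f x.1 x.2.2) else (f x.1 x.2.2, x.2.2)
  have hg : ∀ x, min (d (g x).1) (d (g x).2) ≤ d x.2.2 := by
    rintro ⟨i, b, v⟩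
    cases b
    · exact min_le_right _ _
    · exact min_le_left _ _
  have hsurj : Set.SurjOn g Set.univ E := by
    rintro ⟨u, v⟩ he
    have hadj : G.toSimpleGraphInclusive.Adj u v := by
      refine ⟨?_, Or.inl (hE _ he)⟩
      rintro rfl
      exact hG _ (hE _ he)
    have hmem : s(u, v) ∈ ⋃ i, (T i).edgeSet := hTG ▸ hadj
    obtain ⟨i, hi⟩ := Set.mem_iUnion.1 hmem
    rcases hf i u v hi with h | h
    · exact ⟨(i, true, u), by simp, by simp [g, h]⟩
    · exact ⟨(i, false, v), by simp, by simp [g, h]⟩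
  -- Keep one preimage for each edge, so that each edge is charged exactly once.
  obtain ⟨U, -, hinj, hU⟩ := Finset.exists_subset_injOn_image_eq_of_surjOn _ _ hsurj
  calc ∑ e ∈ E, min (d e.1) (d e.2)
      = ∑ x ∈ U, min (d (g x).1) (d (g x).2) := by rw [← hU, Finset.sum_image hinj]
    _ ≤ ∑ x ∈ U, d x.2.2 := Finset.sum_le_sum fun x _ => hg x
    _ ≤ ∑ x : Fin G.toSimpleGraphInclusive.arboricity × Bool × V, d x.2.2 :=
        Finset.sum_le_sum_of_subset (Finset.subset_univ _)
    _ = 2 * G.toSimpleGraphInclusive.arboricity * ∑ v, d v := by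
        simp only [Fintype.sum_prod_type, Finset.sum_const, Finset.card_univ, Fintype.card_fin,
          Fintype.card_bool, smul_eq_mul]
        ring

/-! ### The first boundary group -/

namespace PathHomology

variable {V : Type*} {F : Type*} [Field F] {G : Digraph V}

open Classical in
theorem boundary_single_two {u v w : V} (huv : u ≠ v) (hvw : v ≠ w) :
    boundary F V 1 (Finsupp.single ![u, v, w] 1) =
      edgeChain F v w - (if u = w then 0 else edgeChain F u w) + edgeChain F u v := by
  have h0 : (fun i : Fin 2 => (![u, v, w] : Fin 3 → V) ((0 : Fin 3).succAbove i)) = ![v, w] := by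
    ext i; fin_cases i <;> rfl
  have h1 : (fun i : Fin 2 => (![u, v, w] : Fin 3 → V) ((1 : Fin 3).succAbove i)) = ![u, w] := by
    ext i; fin_cases i <;> rfl
  have h2 : (fun i : Fin 2 => (![u, v, w] : Fin 3 → V) ((2 : Fin 3).succAbove i)) = ![u, v] := by
    ext i; fin_cases i <;> rfl
  have hr : ∀ a b : V, IsRegularPath (d := 1) ![a, b] ↔ a ≠ b := by
    intro a b
    simp [IsRegularPath, Fin.forall_fin_one]
  rw [boundary, Finsupp.linearCombination_single, one_smul, Fin.sum_univ_three]
  simp only [Nat.reduceAdd] at *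
  rw [h0, h1, h2]
  simp only [hr, edgeChain]
  by_cases huw : u = w
  · subst huw
    simp [huv, hvw]
  · simp [huv, hvw, huw]
    abel

theorem single_mem_allowedChains {d : ℕ} {p : Fin (d + 1) → V} (hp : IsAllowedPath G p) :
    Finsupp.single p (1 : F) ∈ allowedChains F G d :=
  Submodule.subset_span ⟨p, hp, rfl⟩

theorem edgeChain_mem_allowedChains {u v : V} (h : G.Adj u v) :
    edgeChain F u v ∈ allowedChains F G 1 :=
  single_mem_allowedChains (d := 1) fun i => by
    rw [Subsingleton.elim i 0]
    exact h

theorem single_two_mem_allowedChains {u v w : V} (h : G.Adj u v) (h' : G.Adj v w) :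
    Finsupp.single ![u, v, w] (1 : F) ∈ allowedChains F G 2 :=
  single_mem_allowedChains (d := 2) fun i => by
    fin_cases i
    · exact h
    · exact h'

theorem mem_boundaryGroup_one_of_boundary_eq {x : Chain F V 2} {y : Chain F V 1}
    (hx : x ∈ allowedChains F G 2) (hy : y ∈ allowedChains F G 1) (h : boundary F V 1 x = y) :
    y ∈ boundaryGroup F G 1 :=
  ⟨x, ⟨hx, by simpa [h] using hy⟩, h⟩

/-- The preimages under $\partial$ are $e_{uvu}$, $e_{uvw}$ and $e_{uvw}-e_{uzw}$; in the last one
the possibly forbidden face $e_{uw}$ cancels. -/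
theorem SmallCycle.OccursIn.toChain_mem (hG : ∀ v, ¬ G.Adj v v) {z : SmallCycle V}
    (hz : z.OccursIn G) : z.toChain F ∈ boundaryGroup F G 1 := by
  have hne : ∀ {u v}, G.Adj u v → u ≠ v := by
    rintro u _ h rfl
    exact hG _ h
  cases z with
  | bigon u v =>
    obtain ⟨h1, h2⟩ := hz
    refine mem_boundaryGroup_one_of_boundary_eq (single_two_mem_allowedChains h1 h2)
      (add_mem (edgeChain_mem_allowedChains h1) (edgeChain_mem_allowedChains h2)) ?_
    rw [boundary_single_two (hne h1) (hne h2), if_pos rfl, sub_zero, SmallCycle.toChain, add_comm]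
  | triangle u w v =>
    obtain ⟨h1, h2, h3⟩ := hz
    refine mem_boundaryGroup_one_of_boundary_eq (single_two_mem_allowedChains h1 h2)
      (add_mem (sub_mem (edgeChain_mem_allowedChains h2) (edgeChain_mem_allowedChains h3))
        (edgeChain_mem_allowedChains h1)) ?_
    rw [boundary_single_two (hne h1) (hne h2), if_neg (hne h3), SmallCycle.toChain]
  | quadrangle u w v z =>
    obtain ⟨h1, h2, h3, h4, h5, h6⟩ := hz
    refine mem_boundaryGroup_one_of_boundary_eq
      (sub_mem (single_two_mem_allowedChains h1 h2) (single_two_mem_allowedChains h3 h4))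
      (sub_mem (sub_mem (add_mem (edgeChain_mem_allowedChains h1) (edgeChain_mem_allowedChains h2))
        (edgeChain_mem_allowedChains h3)) (edgeChain_mem_allowedChains h4)) ?_
    rw [map_sub, boundary_single_two (hne h1) (hne h2), boundary_single_two (hne h3) (hne h4),
      if_neg h5, SmallCycle.toChain]
    abel

/-- A subspace that contains the chains of all small cycles contains the first boundary group. -/
theorem boundaryGroup_one_le (hG : ∀ v, ¬ G.Adj v v) (S : Submodule F (Chain F V 1))
    (hS : ∀ z : SmallCycle V, z.OccursIn G → z.toChain F ∈ S) : boundaryGroup F G 1 ≤ S := by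
  classical
  have hne : ∀ {u v}, G.Adj u v → u ≠ v := by
    rintro u _ h rfl
    exact hG _ h
  -- The class of $\partial e_{uvw}$ modulo `S`: quadrangles make it independent of `v`, bigons and
  -- triangles make it zero in the remaining cases.
  let f : V → V → Chain F V 1 ⧸ S := fun u w =>
    if h : u ≠ w ∧ ¬ G.Adj u w ∧ ∃ v, G.Adj u v ∧ G.Adj v w then
      S.mkQ (boundary F V 1 (Finsupp.single ![u, h.2.2.choose, w] 1)) else 0
  have hf : ∀ u v w, G.Adj u v → G.Adj v w →
      S.mkQ (boundary F V 1 (Finsupp.single ![u, v, w] 1)) = f u w := by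
    intro u v w h1 h2
    simp only [f]
    split_ifs with h
    · obtain ⟨h3, h4⟩ := h.2.2.choose_spec
      rw [← sub_eq_zero, ← map_sub, Submodule.mkQ_apply, Submodule.Quotient.mk_eq_zero]
      by_cases hv : v = h.2.2.choose
      · rw [← hv, sub_self]
        exact zero_mem _
      · have := hS (.quadrangle u w v h.2.2.choose) ⟨h1, h2, h3, h4, h.1, hv⟩
        convert this using 1
        rw [boundary_single_two (hne h1) (hne h2), boundary_single_two (hne h3) (hne h4),
          if_neg h.1, SmallCycle.toChain]
        abel
    · rw [Submodule.mkQ_apply, Submodule.Quotient.mk_eq_zero, boundary_single_two (hne h1) (hne h2)]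
      by_cases huw : u = w
      · subst huw
        rw [if_pos rfl, sub_zero, add_comm (edgeChain F v u)]
        exact hS (.bigon u v) ⟨h1, h2⟩
      · rw [if_neg huw]
        refine hS (.triangle u w v) ⟨h1, h2, ?_⟩
        by_contra hA
        exact h ⟨huw, hA, v, h1, h2⟩
  -- The sign matches that of the middle face in $\partial e_{uvw}$, so `g` and the quotient map
  -- agree on boundaries of allowed 2-chains, although `g` vanishes on allowed 1-chains.
  let g : Chain F V 1 →ₗ[F] Chain F V 1 ⧸ S :=
    Finsupp.linearCombination F fun p : Fin 2 → V => -f (p 0) (p 1)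
  have hg : ∀ u w, g (edgeChain F u w) = -f u w := by
    intro u w
    simp [g, edgeChain]
  have hf0 : ∀ u w, G.Adj u w → f u w = 0 := fun u w h => dif_neg fun h' => h'.2.1 h
  have hg0 : ∀ y ∈ allowedChains F G 1, g y = 0 := by
    intro y hy
    refine (Submodule.span_le (p := LinearMap.ker g)).2 ?_ hy
    rintro _ ⟨p, hp, rfl⟩
    have hp' : G.Adj (p 0) (p 1) := hp 0
    simp [g, hf0 _ _ hp']
  have hgd : ∀ x ∈ allowedChains F G 2, g (boundary F V 1 x) = S.mkQ (boundary F V 1 x) := by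
    intro x hx
    refine (Submodule.span_le (p := LinearMap.eqLocus (g ∘ₗ boundary F V 1)
      (S.mkQ ∘ₗ boundary F V 1))).2 ?_ hx
    rintro _ ⟨p, hp, rfl⟩
    have h1 : G.Adj (p 0) (p 1) := hp 0
    have h2 : G.Adj (p 1) (p 2) := hp 1
    have hp' : p = ![p 0, p 1, p 2] := by
      ext i; fin_cases i <;> rfl
    rw [hp']
    simp only [SetLike.mem_coe, LinearMap.mem_eqLocus, LinearMap.comp_apply]
    rw [hf _ _ _ h1 h2, boundary_single_two (hne h1) (hne h2), map_add, map_sub, hg, hg,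
      hf0 _ _ h1, hf0 _ _ h2]
    split_ifs with h
    · rw [h]
      have : f (p 2) (p 2) = 0 := dif_neg fun h' => h'.1 rfl
      simp [this]
    · simp [hg]
  rintro _ ⟨x, ⟨hx1, hx2⟩, rfl⟩
  rw [← Submodule.Quotient.mk_eq_zero, ← Submodule.mkQ_apply, ← hgd x hx1]
  exact hg0 _ hx2

/-- For a weight `d` on the vertices, the list `L` holds what a search from `v` through its
neighbours of at most the same weight has to find. If this is so for all `v`, then `L` generates
the first boundary group. -/
structure CompleteAt (G : Digraph V) (d : V → ℕ) (L : List (SmallCycle V)) (v : V) : Prop where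
  bigon : ∀ u, G.Adj v u → G.Adj u v → d u ≤ d v → .bigon v u ∈ L
  triangle_source : ∀ u w, G.Adj v u → G.Adj u w → G.Adj v w → d u ≤ d v → .triangle v w u ∈ L
  triangle_middle : ∀ u w, G.Adj u v → G.Adj u w → G.Adj v w → d u ≤ d v → .triangle u w v ∈ L
  -- The representative `r` depends on `w` only, not on `u`. It may be any middle vertex: no bound
  -- on its weight is needed here.
  source : ∀ w, ∃ r, ∀ u, G.Adj v u → G.Adj u w → d u ≤ d v →
    (G.Adj v r ∧ G.Adj r w) ∧ (v ≠ w → r ≠ u → .quadrangle v w r u ∈ L)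
  sink : ∀ w, ∃ r, ∀ u, G.Adj u v → G.Adj w u → d u ≤ d v →
    (G.Adj r v ∧ G.Adj w r) ∧ (w ≠ v → r ≠ u → .quadrangle w v r u ∈ L)
  -- Here the bound on `d r` matters: `r` itself is inserted as an end when the fixed row and the
  -- fixed column are combined.
  middle_in : ∀ z, ∃ r, ∀ u w, G.Adj u v → G.Adj u z → d u ≤ d v →
    G.Adj v w → G.Adj z w → d w ≤ d v →
    (G.Adj r v ∧ G.Adj r z ∧ d r ≤ d v) ∧ (r ≠ w → v ≠ z → .quadrangle r w v z ∈ L)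
  middle_out : ∀ z, ∃ r, ∀ u w, G.Adj u v → G.Adj u z → d u ≤ d v →
    G.Adj v w → G.Adj z w → d w ≤ d v →
    (G.Adj v r ∧ G.Adj z r ∧ d r ≤ d v) ∧ (u ≠ r → v ≠ z → .quadrangle u r v z ∈ L)

theorem CompleteAt.mono {d : V → ℕ} {L L' : List (SmallCycle V)} {v : V}
    (h : CompleteAt G d L v) (hL : L ⊆ L') : CompleteAt G d L' v where
  bigon u h1 h2 h3 := hL (h.bigon u h1 h2 h3)
  triangle_source u w h1 h2 h3 h4 := hL (h.triangle_source u w h1 h2 h3 h4)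
  triangle_middle u w h1 h2 h3 h4 := hL (h.triangle_middle u w h1 h2 h3 h4)
  source w := (h.source w).imp fun _ hr u h1 h2 h3 =>
    ⟨(hr u h1 h2 h3).1, fun h4 h5 => hL ((hr u h1 h2 h3).2 h4 h5)⟩
  sink w := (h.sink w).imp fun _ hr u h1 h2 h3 =>
    ⟨(hr u h1 h2 h3).1, fun h4 h5 => hL ((hr u h1 h2 h3).2 h4 h5)⟩
  middle_in z := (h.middle_in z).imp fun _ hr u w h1 h2 h3 h4 h5 h6 =>
    ⟨(hr u w h1 h2 h3 h4 h5 h6).1, fun h7 h8 => hL ((hr u w h1 h2 h3 h4 h5 h6).2 h7 h8)⟩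
  middle_out z := (h.middle_out z).imp fun _ hr u w h1 h2 h3 h4 h5 h6 =>
    ⟨(hr u w h1 h2 h3 h4 h5 h6).1, fun h7 h8 => hL ((hr u w h1 h2 h3 h4 h5 h6).2 h7 h8)⟩

/-! ### Completeness at every vertex implies generation -/

section Complete

variable {d : V → ℕ} {L : List (SmallCycle V)}

theorem bigon_mem_or (hL : ∀ v, CompleteAt G d L v) {u v : V} (h1 : G.Adj u v) (h2 : G.Adj v u) :
    .bigon u v ∈ L ∨ .bigon v u ∈ L := by
  rcases le_total (d u) (d v) with h | h
  · exact Or.inr ((hL v).bigon u h2 h1 h)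
  · exact Or.inl ((hL u).bigon v h1 h2 h)

/-- Only source and middle vertex are compared: the triangle is found from the heavier of the two,
and the weight of the sink plays no role. -/
theorem triangle_mem (hL : ∀ v, CompleteAt G d L v) {u v w : V} (h1 : G.Adj u v) (h2 : G.Adj v w)
    (h3 : G.Adj u w) : .triangle u w v ∈ L := by
  rcases le_total (d u) (d v) with h | h
  · exact (hL v).triangle_middle u w h1 h3 h2 h
  · exact (hL u).triangle_source v w h1 h2 h3 h

theorem span_eq_boundaryGroup (hG : ∀ v, ¬ G.Adj v v) (hocc : ∀ z ∈ L, z.OccursIn G)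
    (hL : ∀ v, CompleteAt G d L v) :
    Submodule.span F {x | ∃ z ∈ L, x = z.toChain F} = boundaryGroup F G 1 := by
  set S := Submodule.span F {x | ∃ z ∈ L, x = z.toChain F} with hSdef
  have hmem : ∀ z ∈ L, z.toChain F ∈ S := fun z hz => Submodule.subset_span ⟨z, hz, rfl⟩
  have hbi : ∀ u v, G.Adj u v → G.Adj v u → edgeChain F u v + edgeChain F v u ∈ S := by
    intro u v h1 h2
    rcases bigon_mem_or hL h1 h2 with h | h
    · exact hmem _ h
    · rw [add_comm (edgeChain F u v)]
      exact hmem _ h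
  have hquad : ∀ {u w v z}, G.Adj u v → G.Adj v w → G.Adj u z → G.Adj z w →
      (u ≠ w → v ≠ z → .quadrangle u w v z ∈ L) →
      edgeChain F u v + edgeChain F v w - edgeChain F u z - edgeChain F z w ∈ S := by
    intro u w v z h1 h2 h3 h4 h
    -- The degenerate quadrangles that the relations below may produce: a difference of two bigons
    -- if the ends coincide, zero if the middle vertices do.
    by_cases huw : u = w
    · subst huw
      have := sub_mem (hbi u v h1 h2) (hbi u z h3 h4)
      rwa [← sub_sub] at this
    by_cases hvz : v = z
    · subst hvz
      convert zero_mem S using 1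
      abel
    · exact hmem _ (h huw hvz)
  apply le_antisymm
  · rw [hSdef, Submodule.span_le]
    rintro _ ⟨z, hz, rfl⟩
    exact (hocc z hz).toChain_mem hG
  refine boundaryGroup_one_le hG S ?_
  rintro (⟨u, v⟩ | ⟨u, w, v⟩ | ⟨u, w, v, z⟩) hz
  · exact hbi u v hz.1 hz.2
  · exact hmem _ (triangle_mem hL hz.1 hz.2.1 hz.2.2)
  obtain ⟨h1, h2, h3, h4, huw, hvz⟩ := hz
  simp only [SmallCycle.toChain]
  -- the case where a middle vertex has the largest weight
  have hmid : ∀ {v z}, G.Adj u v → G.Adj v w → G.Adj u z → G.Adj z w → d u ≤ d v → d w ≤ d v →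
      edgeChain F u v + edgeChain F v w - edgeChain F u z - edgeChain F z w ∈ S := by
    intro v z h1 h2 h3 h4 hu hw
    obtain ⟨r, hr⟩ := (hL v).middle_in z
    obtain ⟨s, hs⟩ := (hL v).middle_out z
    obtain ⟨⟨r1, r2, r3⟩, hr1⟩ := hr u w h1 h3 hu h2 h4 hw
    obtain ⟨⟨s1, s2, s3⟩, hs1⟩ := hs u w h1 h3 hu h2 h4 hw
    -- Row and column representatives `r`, `s`. With `v`, `z` fixed, the quadrangle chain is a
    -- function of `u` plus a function of `w`, so $Q(u,w)=Q(r,w)+Q(u,s)-Q(r,s)$.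
    have hrs := (hr u s h1 h3 hu s1 s2 s3).2
    have := sub_mem (add_mem (hquad r1 h2 r2 h4 hr1) (hquad h1 s1 h3 s2 hs1))
      (hquad r1 s1 r2 s2 hrs)
    convert this using 1
    abel
  have hsrc : d v ≤ d u → d z ≤ d u →
      edgeChain F u v + edgeChain F v w - edgeChain F u z - edgeChain F z w ∈ S := by
    intro hv hz
    obtain ⟨r, hr⟩ := (hL u).source w
    obtain ⟨⟨r1, r2⟩, hrv⟩ := hr v h1 h2 hv
    obtain ⟨-, hrz⟩ := hr z h3 h4 hz
    have := sub_mem (hquad r1 r2 h3 h4 hrz) (hquad r1 r2 h1 h2 hrv)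
    convert this using 1
    abel
  have hsnk : d v ≤ d w → d z ≤ d w →
      edgeChain F u v + edgeChain F v w - edgeChain F u z - edgeChain F z w ∈ S := by
    intro hv hz
    obtain ⟨r, hr⟩ := (hL w).sink u
    obtain ⟨⟨r1, r2⟩, hrv⟩ := hr v h2 h1 hv
    obtain ⟨-, hrz⟩ := hr z h4 h3 hz
    have := sub_mem (hquad r2 r1 h3 h4 hrz) (hquad r2 r1 h1 h2 hrv)
    convert this using 1
    abel
  -- If neither middle vertex dominates both ends, then the heavier end outweighs both middle
  -- vertices.
  by_cases hv : d u ≤ d v ∧ d w ≤ d v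
  · exact hmid h1 h2 h3 h4 hv.1 hv.2
  by_cases hz : d u ≤ d z ∧ d w ≤ d z
  · have := neg_mem (hmid h3 h4 h1 h2 hz.1 hz.2)
    convert this using 1
    abel
  rcases le_total (d u) (d w) with h | h
  · exact hsnk (by omega) (by omega)
  · exact hsrc (by omega) (by omega)

end Complete

end PathHomology

namespace RAM

open PathHomology

variable {W n : ℕ}

/-! ### Adjacency lists

The side `false` of a vertex are its out-neighbours, the side `true` its in-neighbours. -/

/-- The neighbours of `v` on the side `b`, the latest edge first. -/
def nbrs (es : List (Fin n × Fin n)) (b : Bool) (v : Fin n) : List (Fin n) :=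
  ((es.filter fun e => cond b e.2 e.1 = v).map fun e => cond b e.1 e.2).reverse

theorem mem_nbrs {es : List (Fin n × Fin n)} {b : Bool} {u v : Fin n} :
    u ∈ nbrs es b v ↔ cond b (u, v) (v, u) ∈ es := by
  cases b
  · simp [nbrs]
  · simp [nbrs]

theorem nbrs_append_singleton (es : List (Fin n × Fin n)) (b : Bool) (e : Fin n × Fin n)
    (v : Fin n) : nbrs (es ++ [e]) b v =
      if cond b e.2 e.1 = v then cond b e.1 e.2 :: nbrs es b v else nbrs es b v := by
  simp only [nbrs, List.filter_append]
  split_ifs with h <;> simp [h]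

/-- The number of edges at `v`. -/
def degree (es : List (Fin n × Fin n)) (v : Fin n) : ℕ :=
  (nbrs es false v).length + (nbrs es true v).length

theorem length_nbrs_le_degree (es : List (Fin n × Fin n)) (b : Bool) (v : Fin n) :
    (nbrs es b v).length ≤ degree es v := by
  cases b <;> simp [degree]

/-- The array of the list heads. -/
def hdA (b : Bool) : ℕ := cond b 5 2
/-- The array of the links. -/
def nxtA (b : Bool) : ℕ := cond b 6 3
/-- The array of the list entries. -/
def dstA (b : Bool) : ℕ := cond b 7 4

theorem hdA_lt (b : Bool) : hdA b < 10 := by cases b <;> simp [hdA]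
theorem nxtA_lt (b : Bool) : nxtA b < 10 := by cases b <;> simp [nxtA]
theorem dstA_lt (b : Bool) : dstA b < 10 := by cases b <;> simp [dstA]

/-- The adjacency lists, the degrees and the constants are in place. -/
structure Ready (es : List (Fin n × Fin n)) (σ : State) : Prop where
  reg0 : σ.reg 0 = n
  reg1 : σ.reg 1 = es.length
  reg2 : σ.reg 2 = 0
  reg3 : σ.reg 3 = 1
  reg4 : σ.reg 4 = 2
  reg5 : σ.reg 5 = 3
  reg6 : σ.reg 6 = 4
  edge : ∀ (b : Bool) i (h : i < es.length), σ.arr b.toNat i = (cond b es[i].2 es[i].1 : Fin n)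
  linked : ∀ b (v : Fin n),
    Linked (σ.arr (nxtA b)) (σ.arr (dstA b)) (σ.arr (hdA b) v) (nbrs es b v)
  head : ∀ b (v : Fin n), nbrs es b v ≠ [] → ∃ i, ∃ h : i < es.length,
    cond b es[i].2 es[i].1 = v ∧ σ.arr (hdA b) v = i + 1
  deg : ∀ v : Fin n, σ.arr 8 v = degree es v

theorem Ready.of_agree {es : List (Fin n × Fin n)} {σ σ' : State} {k : ℕ} (h : Ready es σ)
    (hag : σ.Agree k σ') (hk : 7 ≤ k) : Ready es σ' where
  reg0 := by rw [hag.reg _ (by omega), h.reg0]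
  reg1 := by rw [hag.reg _ (by omega), h.reg1]
  reg2 := by rw [hag.reg _ (by omega), h.reg2]
  reg3 := by rw [hag.reg _ (by omega), h.reg3]
  reg4 := by rw [hag.reg _ (by omega), h.reg4]
  reg5 := by rw [hag.reg _ (by omega), h.reg5]
  reg6 := by rw [hag.reg _ (by omega), h.reg6]
  edge b i hi := by rw [hag.arr _ (by cases b <;> simp), h.edge b i hi]
  linked b v := by
    rw [hag.arr _ (hdA_lt b), hag.arr _ (nxtA_lt b), hag.arr _ (dstA_lt b)]
    exact h.linked b v
  head b v := by
    rw [hag.arr _ (hdA_lt b)]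
    exact h.head b v
  deg v := by rw [hag.arr _ (by omega), h.deg]

/-- The machine is about to search around the vertex `v`. -/
structure Visiting (W : ℕ) (es : List (Fin n × Fin n)) (v : Fin n) (σ : State) : Prop where
  ready : Ready es σ
  bounded : σ.Bounded W
  reg8 : σ.reg 8 = v
  reg9 : σ.reg 9 = degree es v

theorem Visiting.of_agree {es : List (Fin n × Fin n)} {v : Fin n} {σ σ' : State}
    (h : Visiting W es v σ) (hag : σ.Agree 10 σ') (hb : σ'.Bounded W) : Visiting W es v σ' where
  ready := h.ready.of_agree hag (by omega)
  bounded := hb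
  reg8 := by rw [hag.reg _ (by omega), h.reg8]
  reg9 := by rw [hag.reg _ (by omega), h.reg9]

/-! ### Wedges -/

/-- `u` is a neighbour of `v` of at most the same degree, and `w` is a neighbour of `u`. -/
def IsWedge (es : List (Fin n × Fin n)) (b₁ b₂ : Bool) (v u w : Fin n) : Prop :=
  u ∈ nbrs es b₁ v ∧ degree es u ≤ degree es v ∧ w ∈ nbrs es b₂ u

/-- A bound for the number of wedges at `v`. -/
def wedgeCost (es : List (Fin n × Fin n)) (v : Fin n) : ℕ :=
  ((nbrs es false v).map fun u => 1 + min (degree es u) (degree es v)).sum +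
    ((nbrs es true v).map fun u => 1 + min (degree es u) (degree es v)).sum

/-- Run `body` for all wedges at the vertex in register `8`, with `u` in register `11` and `w` in
register `14`. -/
def wedges (b₁ b₂ : Bool) (body : Prog) : Prog :=
  .seq (.instr (.load 10 (hdA b₁) 8)) <|
    walk (nxtA b₁) (dstA b₁) 10 <|
      .seq (.instr (.load 12 8 11)) <| .ite (.lt 9 12) .skip <|
        .seq (.instr (.load 13 (hdA b₂) 11)) <| walk (nxtA b₂) (dstA b₂) 13 body

theorem avoids_wedges {b₁ b₂ : Bool} {body : Prog} (h : body.Avoids 10) :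
    (wedges b₁ b₂ body).Avoids 10 := by
  simp [wedges, walk, Prog.Avoids, Instr.Avoids, h]

/-- A neighbour `u` of larger degree than `v` is dismissed after one comparison; any other costs at
most its degree. Both are covered by $1+\min(\deg u,\deg v)$ up to a constant factor. -/
theorem Runs.wedges {es : List (Fin n × Fin n)} {b₁ b₂ : Bool} {body : Prog}
    (hbody : body.Avoids 15) {σ₀ : State} {v : Fin n} (hv : Visiting W es v σ₀)
    (I : List (Fin n × Fin n) → (ℕ → ℕ → ℕ) → List ℕ → Prop) (B : ℕ)
    (step : ∀ (done : List (Fin n × Fin n)) (u w : Fin n) (σ : State), IsWedge es b₁ b₂ v u w →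
      Visiting W es v σ → σ.reg 11 = u → σ.reg 14 = w → I done σ.arr σ.out →
        Runs W body B σ fun σ' => I (done ++ [(u, w)]) σ'.arr σ'.out)
    (h0 : I [] σ₀.arr σ₀.out) :
    Runs W (wedges b₁ b₂ body) ((B + 20) * (1 + wedgeCost es v)) σ₀ fun σ' =>
      ∃ done, (∀ u w, IsWedge es b₁ b₂ v u w → (u, w) ∈ done) ∧ I done σ'.arr σ'.out := by
  set cost : Fin n → ℕ := fun u =>
    1 + (1 + (if degree es u ≤ degree es v then 2 + (B + 3) * (nbrs es b₂ u).length else 1))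
    with hcost
  have hsum : 2 + ((nbrs es b₁ v).map fun u => cost u + 3).sum ≤
      (B + 20) * (1 + wedgeCost es v) := by
    have h1 : ((nbrs es b₁ v).map fun u => cost u + 3).sum ≤
        ((nbrs es b₁ v).map fun u => (B + 20) * (1 + min (degree es u) (degree es v))).sum := by
      refine List.sum_le_sum fun u _ => ?_
      have := length_nbrs_le_degree es b₂ u
      simp only [hcost]
      split_ifs with h
      · rw [min_eq_left h]
        have := Nat.mul_le_mul_left (B + 3) this
        nlinarith
      · nlinarith [Nat.zero_le (min (degree es u) (degree es v))]
    have h2 : ((nbrs es b₁ v).map fun u => 1 + min (degree es u) (degree es v)).sum ≤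
        wedgeCost es v := by
      cases b₁ <;> simp [wedgeCost]
    rw [List.sum_map_mul_left] at h1
    nlinarith
  have hag1 : σ₀.Agree 10 (Instr.next σ₀ (.load 10 (hdA b₁) 8)) := by
    refine ⟨fun r hr => ?_, fun _ _ => rfl⟩
    simp only [Instr.next]
    rw [Function.update_of_ne (by omega)]
  have hb1 : (Instr.next σ₀ (.load 10 (hdA b₁) 8)).Bounded W :=
    (Exec.instr _ _ (hv.bounded.2 _ _)).bounded hv.bounded
  have hr1 := hv.ready.of_agree hag1 (by omega)
  refine (Runs.instr_seq _ (hv.bounded.2 _ _) (Runs.walk (n := n) (nxtA_lt b₁) (dstA_lt b₁)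
    (by omega) ?_ hr1.reg2
    (fun done arr out => ∃ acc, (∀ u ∈ done, ∀ w, IsWedge es b₁ b₂ v u w → (u, w) ∈ acc) ∧
      I acc arr out) cost (nbrs es b₁ v) ?_ hb1 ⟨[], by simp, h0⟩ ?_)).mono (by omega) ?_
  · have := hbody.mono (show 12 ≤ 15 by omega)
    simp [RAM.walk, Prog.Avoids, Instr.Avoids, this]
  · rintro done u rest hl σ hag hb h11 ⟨acc, hacc, hI⟩
    have hu : u ∈ nbrs es b₁ v := by simp [← hl]
    have hvis := hv.of_agree (hag1.trans hag) hb
    have hdeg : (Instr.next σ (.load 12 8 11)).reg 12 = degree es u := by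
      simp [Instr.next, Instr.value, h11, hvis.ready.deg]
    have hag2 : σ.Agree 12 (Instr.next σ (.load 12 8 11)) := by
      refine ⟨fun r hr => ?_, fun _ _ => rfl⟩
      simp only [Instr.next]
      rw [Function.update_of_ne (by omega)]
    have hb2 : (Instr.next σ (.load 12 8 11)).Bounded W :=
      (Exec.instr _ _ (hb.2 _ _)).bounded hb
    have h9 : (Instr.next σ (.load 12 8 11)).reg 9 = degree es v := by
      rw [hag2.reg _ (by omega), hvis.reg9]
    set σ₂ := Instr.next σ (.load 12 8 11) with hσ₂
    refine (Runs.instr_seq _ (hb.2 _ _) (Runs.ite (T := if degree es u ≤ degree es v then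
      2 + (B + 3) * (nbrs es b₂ u).length else 1) ?_ ?_)).mono (by simp only [hcost]; omega)
      fun _ h => h
    · intro hlt
      simp only [Test.Holds, ← hσ₂, hdeg, h9] at hlt
      rw [if_neg (by omega)]
      refine Runs.skip ⟨acc, ?_, hI⟩
      intro u' hu' w hw
      rcases List.mem_append.1 hu' with h | h
      · exact hacc _ h _ hw
      · rw [List.mem_singleton] at h
        subst h
        exact absurd hw.2.1 (by omega)
    · intro hlt
      simp only [Test.Holds, ← hσ₂, hdeg, h9] at hlt
      have hle : degree es u ≤ degree es v := by omega
      rw [if_pos hle]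
      have hag3 : σ₂.Agree 13 (Instr.next σ₂ (.load 13 (hdA b₂) 11)) := by
        refine ⟨fun r hr => ?_, fun _ _ => rfl⟩
        simp only [Instr.next]
        rw [Function.update_of_ne (by omega)]
      have hb3 : (Instr.next σ₂ (.load 13 (hdA b₂) 11)).Bounded W :=
        (Exec.instr _ _ (hb2.2 _ _)).bounded hb2
      have hvis3 := (hvis.of_agree (hag2.mono (by omega)) hb2).of_agree (hag3.mono (by omega)) hb3
      have h311 : (Instr.next σ₂ (.load 13 (hdA b₂) 11)).reg 11 = u := by
        rw [hag3.reg _ (by omega), hag2.reg _ (by omega), h11]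
      refine (Runs.instr_seq _ (hb2.2 _ _) (Runs.walk (n := n) (nxtA_lt b₂) (dstA_lt b₂) (by omega)
        hbody hvis3.ready.reg2
        (fun done' arr out => ∃ acc', acc ⊆ acc' ∧ (∀ w ∈ done', (u, w) ∈ acc') ∧ I acc' arr out)
        (fun _ => B) (nbrs es b₂ u) ?_ hb3 ⟨acc, fun _ h => h, by simp, hI⟩ ?_)).mono ?_ ?_
      · rintro done' w rest' hl' σ' hag' hb' h14 ⟨acc', hsub, hacc', hI'⟩
        have hw : IsWedge es b₁ b₂ v u w := ⟨hu, hle, by simp [← hl']⟩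
        refine (step acc' u w σ' hw (hvis3.of_agree (hag'.mono (by omega)) hb')
          (by rw [hag'.reg _ (by omega), h311]) h14 hI').mono le_rfl fun σ'' h'' =>
            ⟨_, fun x hx => List.mem_append_left _ (hsub hx), ?_, h''⟩
        intro w' hw'
        rcases List.mem_append.1 hw' with h | h
        · exact List.mem_append_left _ (hacc' _ h)
        · simp only [List.mem_singleton] at h
          simp [h]
      · have h313 : (Instr.next σ₂ (.load 13 (hdA b₂) 11)).reg 13 = σ.arr (hdA b₂) u := by
          have : σ₂.reg 11 = u := by rw [hag2.reg _ (by omega), h11]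
          simp only [Instr.next, Instr.value, this, Function.update_self]
          rfl
        rw [h313]
        exact hvis.ready.linked b₂ u
      · simp only [List.map_const', List.sum_replicate, smul_eq_mul]
        nlinarith
      · rintro σ' ⟨acc', hsub, hacc', hI'⟩
        refine ⟨acc', ?_, hI'⟩
        intro u' hu' w hw
        rcases List.mem_append.1 hu' with h | h
        · exact hsub (hacc _ h _ hw)
        · rw [List.mem_singleton] at h
          subst h
          exact hacc' _ hw.2.2
  · have : (Instr.next σ₀ (.load 10 (hdA b₁) 8)).reg 10 = σ₀.arr (hdA b₁) v := by
      simp [Instr.next, Instr.value, hv.reg8]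
    rw [this]
    exact hv.ready.linked b₁ v
  · rintro σ' ⟨acc, hacc, hI⟩
    exact ⟨acc, fun u w h => hacc u h.1 w h, hI⟩

/-! ### Searching for cycles with a table -/

/-- Started around `v`, the program writes down a list of cycles with the property `C`. -/
def Lists (W : ℕ) (es : List (Fin n × Fin n)) (v : Fin n) (p : Prog) (T : ℕ)
    (C : List (SmallCycle (Fin n)) → Prop) : Prop :=
  p.Avoids 10 ∧ ∀ σ, Visiting W es v σ → Runs W p T σ fun σ' =>
    ∃ L, σ'.out = σ.out ++ L.flatMap SmallCycle.encode ∧ C L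

theorem Lists.seq {es : List (Fin n × Fin n)} {v : Fin n} {p q : Prog} {T T' : ℕ}
    {C C' : List (SmallCycle (Fin n)) → Prop} (h : Lists W es v p T C)
    (h' : Lists W es v q T' C') :
    Lists W es v (.seq p q) (T + T') fun L => ∃ L₁ L₂, L = L₁ ++ L₂ ∧ C L₁ ∧ C' L₂ := by
  refine ⟨⟨h.1, h'.1⟩, fun σ hσ => Runs.seq ?_⟩
  refine (((h.2 σ hσ).bounded hσ.bounded).agree h.1).mono le_rfl ?_
  rintro σ' ⟨hag, hb, L, hL, hC⟩
  refine (h'.2 σ' (hσ.of_agree hag hb)).mono le_rfl ?_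
  rintro σ'' ⟨L', hL', hC'⟩
  exact ⟨L ++ L', by simp [hL', hL], L, L', rfl, hC, hC'⟩

/-- Started around `v`, the program stores at every `z` in the table `10` an `x` with `S x z`. -/
def Tabulates (W : ℕ) (es : List (Fin n × Fin n)) (v : Fin n) (p : Prog) (T : ℕ)
    (S : Fin n → Fin n → Prop) : Prop :=
  p.Avoids 10 ∧ ∀ σ, Visiting W es v σ → Runs W p T σ fun σ' => σ'.out = σ.out ∧
    ∀ z : Fin n, (∃ x : Fin n, S x z ∧ σ'.arr 10 z = x) ∨
      ((∀ x, ¬ S x z) ∧ σ'.arr 10 z = σ.arr 10 z)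

/-- For every wedge `(u, z)` and the table entry `x` of `z`, the list holds the cycles
`cyc u z x`. -/
def Found (R S : Fin n → Fin n → Prop) (cyc : Fin n → Fin n → Fin n → List (SmallCycle (Fin n)))
    (L : List (SmallCycle (Fin n))) : Prop :=
  (∀ c ∈ L, ∃ u z x, R u z ∧ S x z ∧ c ∈ cyc u z x) ∧
    ∀ z, ∃ x₀, ∀ u x, R u z → S x z → S x₀ z ∧ ∀ c ∈ cyc u z x₀, c ∈ L

/-- Clear the table, fill it with `writer`, and for every wedge `(u, z)` for which the table has an
entry `x` at `z`, run `em` with `x` in register `15`. -/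
def lookup (b₁ b₂ : Bool) (writer em : Prog) : Prog :=
  .seq (wedges b₁ b₂ (.instr (.store 10 14 0))) <| .seq writer <|
    wedges b₁ b₂ (.seq (.instr (.load 15 10 14)) (.ite (.lt 15 0) em .skip))

/-- The clearing pass runs over the same wedges as the reading pass, so stale entries elsewhere are
never read and no pass over all vertices is needed. -/
theorem Lists.lookup {es : List (Fin n × Fin n)} {v : Fin n} {b₁ b₂ : Bool} {writer em : Prog}
    {S : Fin n → Fin n → Prop} {T : ℕ} (hw : Tabulates W es v writer T S) (hem : em.Avoids 16)
    (cyc : Fin n → Fin n → Fin n → List (SmallCycle (Fin n)))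
    (emits : ∀ (σ : State) (u z x : Fin n), Visiting W es v σ →
      σ.reg 11 = u → σ.reg 14 = z → σ.reg 15 = x → Runs W em 10 σ fun σ' => σ'.arr = σ.arr ∧
        σ'.out = σ.out ++ (cyc u z x).flatMap SmallCycle.encode) :
    Lists W es v (lookup b₁ b₂ writer em) (T + 60 * (1 + wedgeCost es v))
      (Found (IsWedge es b₁ b₂ v) S cyc) := by
  have hav1 : (Prog.instr (.store 10 14 0)).Avoids 15 := by simp [Prog.Avoids, Instr.Avoids]
  have hav2 : (Prog.seq (.instr (.load 15 10 14)) (.ite (.lt 15 0) em .skip)).Avoids 15 := by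
    simp [Prog.Avoids, Instr.Avoids, hem.mono (show 15 ≤ 16 by omega)]
  have hav1' := avoids_wedges (b₁ := b₁) (b₂ := b₂) (hav1.mono (show 10 ≤ 15 by omega))
  refine ⟨⟨hav1', hw.1, avoids_wedges (hav2.mono (by omega))⟩, fun σ₀ hσ₀ => ?_⟩
  have hclear := ((Runs.wedges (b₁ := b₁) (b₂ := b₂) hav1 hσ₀ (fun done arr out =>
    out = σ₀.out ∧ ∀ u z, (u, z) ∈ done → arr 10 z = n) 1 (by
      rintro done u z σ - hσ - h14 ⟨h1, h2⟩
      refine Runs.instr _ (hσ.bounded.1 _) ⟨h1, ?_⟩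
      intro u' z' hz'
      simp only [Instr.next, Instr.value, Function.update_self, h14, hσ.ready.reg0,
        Function.update_apply]
      split_ifs with h
      · rfl
      · rcases List.mem_append.1 hz' with h' | h'
        · exact h2 _ _ h'
        · simp only [List.mem_singleton, Prod.mk.injEq] at h'
          exact absurd (by rw [h'.2]) h) ⟨rfl, by simp⟩).bounded hσ₀.bounded).agree hav1'
  refine (Runs.seq (T' := T + (12 + 20) * (1 + wedgeCost es v)) (hclear.mono le_rfl ?_)).mono
    (by omega) fun _ h => h
  rintro σ₁ ⟨hag1, hb1, done, hdone, hout1, hclr⟩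
  have hσ₁ := hσ₀.of_agree hag1 hb1
  refine Runs.seq ((((hw.2 σ₁ hσ₁).bounded hb1).agree hw.1).mono le_rfl ?_)
  rintro σ₂ ⟨hag2, hb2, hout2, htab⟩
  have hσ₂ := hσ₁.of_agree hag2 hb2
  refine (Runs.wedges hav2 hσ₂ (fun done arr out => arr = σ₂.arr ∧
    ∃ L, out = σ₀.out ++ L.flatMap SmallCycle.encode ∧
      (∀ c ∈ L, ∃ u z x, IsWedge es b₁ b₂ v u z ∧ S x z ∧ c ∈ cyc u z x) ∧
      ∀ u z, (u, z) ∈ done → ∀ x : Fin n, σ₂.arr 10 z = x → ∀ c ∈ cyc u z x, c ∈ L) 12 ?_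
      ⟨rfl, [], by simp [hout1, hout2], by simp, by simp⟩).mono le_rfl ?_
  · rintro done' u z σ huz hσ h11 h14 ⟨harr, L, hL, hL1, hL2⟩
    have hreg15 : (Instr.next σ (.load 15 10 14)).reg 15 = σ₂.arr 10 z := by
      simp [Instr.next, Instr.value, h14, harr]
    have hag : σ.Agree 15 (Instr.next σ (.load 15 10 14)) := by
      refine ⟨fun r hr => ?_, fun _ _ => rfl⟩
      simp only [Instr.next]
      rw [Function.update_of_ne (by omega)]
    have hb3 : (Instr.next σ (.load 15 10 14)).Bounded W :=
      (Exec.instr _ _ (hσ.bounded.2 _ _)).bounded hσ.bounded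
    have hσ₃ := hσ.of_agree (hag.mono (by omega)) hb3
    refine Runs.instr_seq _ (hσ.bounded.2 _ _) (Runs.ite ?_ ?_)
    · intro hlt
      simp only [Test.Holds, hreg15, hσ₃.ready.reg0] at hlt
      -- The cleared value is `n`, which is no vertex, so an entry below `n` was written by
      -- `writer`.
      have hex : ∃ x : Fin n, S x z ∧ σ₂.arr 10 z = x := by
        rcases htab z with h | ⟨-, h⟩
        · exact h
        · rw [h, hclr u z (hdone u z huz)] at hlt
          omega
      obtain ⟨x, hS, hx⟩ := hex
      refine (emits _ u z x hσ₃ (by rw [hag.reg _ (by omega), h11])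
        (by rw [hag.reg _ (by omega), h14]) (hreg15.trans hx)).mono le_rfl ?_
      rintro σ' ⟨ha, ho⟩
      refine ⟨ha.trans harr, L ++ cyc u z x, ?_, ?_, ?_⟩
      · rw [ho]
        simp only [Instr.next, hL]
        simp
      · intro c hc
        rcases List.mem_append.1 hc with h | h
        · exact hL1 c h
        · exact ⟨u, z, x, huz, hS, h⟩
      · intro u' z' h' x' hx' c hc
        rcases List.mem_append.1 h' with h | h
        · exact List.mem_append_left _ (hL2 u' z' h x' hx' c hc)
        · simp only [List.mem_singleton, Prod.mk.injEq] at h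
          obtain ⟨rfl, rfl⟩ := h
          have : x' = x := Fin.ext (hx'.symm.trans hx)
          subst this
          exact List.mem_append_right _ hc
    · intro hlt
      simp only [Test.Holds, hreg15, hσ₃.ready.reg0] at hlt
      refine (Runs.skip ⟨harr, L, hL, hL1, ?_⟩).mono (T' := 10) (by omega) fun _ h => h
      intro u' z' h' x' hx' c hc
      rcases List.mem_append.1 h' with h | h
      · exact hL2 u' z' h x' hx' c hc
      · simp only [List.mem_singleton, Prod.mk.injEq] at h
        obtain ⟨rfl, rfl⟩ := h
        exact absurd (hx' ▸ x'.2) hlt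
  · rintro σ' ⟨done', hdone', -, L, hL, hL1, hL2⟩
    refine ⟨L, hL, hL1, fun z => ?_⟩
    rcases htab z with ⟨x, hS, hx⟩ | ⟨hno, -⟩
    · exact ⟨x, fun u x' hu _ => ⟨hS, fun c hc => hL2 u z (hdone' u z hu) x hx c hc⟩⟩
    -- No entry exists at `z`, so the representative is arbitrary.
    · exact ⟨z, fun u x' _ hx' => absurd hx' (hno x')⟩

/-- Store `u` at the end `w` of every wedge. -/
def writeWedges (b₁ b₂ : Bool) : Prog := wedges b₁ b₂ (.instr (.store 10 14 11))

theorem tabulates_writeWedges (es : List (Fin n × Fin n)) (v : Fin n) (b₁ b₂ : Bool) :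
    Tabulates W es v (writeWedges b₁ b₂) (21 * (1 + wedgeCost es v)) (IsWedge es b₁ b₂ v) := by
  have hav : (Prog.instr (.store 10 14 11)).Avoids 15 := by simp [Prog.Avoids, Instr.Avoids]
  refine ⟨avoids_wedges (hav.mono (by omega)), fun σ₀ hσ₀ => ?_⟩
  refine (Runs.wedges hav hσ₀ (fun done arr out => out = σ₀.out ∧ ∀ z : Fin n,
    (∃ x : Fin n, IsWedge es b₁ b₂ v x z ∧ arr 10 z = x) ∨
      ((∀ x, (x, z) ∉ done) ∧ arr 10 z = σ₀.arr 10 z)) 1 ?_ ⟨rfl, by simp⟩).mono le_rfl ?_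
  · rintro done u w σ huw hσ h11 h14 ⟨h1, h2⟩
    refine Runs.instr _ (hσ.bounded.1 _) ⟨h1, fun z => ?_⟩
    simp only [Instr.next, Instr.value, Function.update_self, h14, h11, Function.update_apply]
    by_cases hz : z = w
    · subst hz
      exact Or.inl ⟨u, huw, by simp⟩
    · rw [if_neg (fun h => hz (Fin.ext h))]
      refine (h2 z).imp_right fun h => ⟨fun x hx => ?_, h.2⟩
      rcases List.mem_append.1 hx with h' | h'
      · exact h.1 x h'
      · simp [hz] at h'
  · rintro σ' ⟨done, hdone, h1, h2⟩
    exact ⟨h1, fun z => (h2 z).imp_right fun h => ⟨fun x hx => h.1 x (hdone x z hx), h.2⟩⟩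

/-- Store `v` at `v`. -/
def writeSelf : Prog := .instr (.store 10 8 8)

theorem tabulates_writeSelf (es : List (Fin n × Fin n)) (v : Fin n) :
    Tabulates W es v writeSelf 1 fun x z => x = v ∧ z = v := by
  refine ⟨by simp [writeSelf, Prog.Avoids, Instr.Avoids], fun σ hσ => ?_⟩
  refine Runs.instr _ (hσ.bounded.1 _) ⟨rfl, fun z => ?_⟩
  simp only [Instr.next, Instr.value, Function.update_self, hσ.reg8, Function.update_apply]
  by_cases hz : z = v
  · exact Or.inl ⟨v, ⟨rfl, hz⟩, by simp [hz]⟩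
  · exact Or.inr ⟨fun x hx => hz hx.2, if_neg (fun h => hz (Fin.ext h))⟩

/-- Store `w` at every out-neighbour `w` of `v`. -/
def writeOut : Prog :=
  .seq (.instr (.load 10 (hdA false) 8)) <|
    walk (nxtA false) (dstA false) 10 (.instr (.store 10 11 11))

theorem tabulates_writeOut (es : List (Fin n × Fin n)) (v : Fin n) :
    Tabulates W es v writeOut (10 * (1 + wedgeCost es v)) fun x z =>
      x = z ∧ z ∈ nbrs es false v := by
  refine ⟨by simp [writeOut, walk, Prog.Avoids, Instr.Avoids], fun σ₀ hσ₀ => ?_⟩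
  have hag1 : σ₀.Agree 10 (Instr.next σ₀ (.load 10 (hdA false) 8)) := by
    refine ⟨fun r hr => ?_, fun _ _ => rfl⟩
    simp only [Instr.next]
    rw [Function.update_of_ne (by omega)]
  have hb1 : (Instr.next σ₀ (.load 10 (hdA false) 8)).Bounded W :=
    (Exec.instr _ _ (hσ₀.bounded.2 _ _)).bounded hσ₀.bounded
  have hr1 := hσ₀.ready.of_agree hag1 (by omega)
  refine (Runs.instr_seq _ (hσ₀.bounded.2 _ _) (Runs.walk (n := n) (nxtA_lt false) (dstA_lt false)
    (by omega) (by simp [Prog.Avoids, Instr.Avoids]) hr1.reg2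
    (fun done arr out => out = σ₀.out ∧ ∀ z : Fin n,
      (∃ x : Fin n, (x = z ∧ z ∈ nbrs es false v) ∧ arr 10 z = x) ∨
        (z ∉ done ∧ arr 10 z = σ₀.arr 10 z)) (fun _ => 1) (nbrs es false v) ?_ hb1
    ⟨rfl, fun z => Or.inr ⟨by simp, rfl⟩⟩ ?_)).mono ?_ ?_
  · rintro done w rest hl σ hag hb h11 ⟨h1, h2⟩
    refine Runs.instr _ (hb.1 _) ⟨h1, fun z => ?_⟩
    simp only [Nat.reduceAdd] at h11
    simp only [Instr.next, Instr.value, Function.update_self, h11, Function.update_apply]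
    by_cases hz : z = w
    · subst hz
      exact Or.inl ⟨z, ⟨rfl, by simp [← hl]⟩, by simp⟩
    · rw [if_neg (fun h => hz (Fin.ext h))]
      exact (h2 z).imp_right fun h => ⟨by simp [h.1, hz], h.2⟩
  · have : (Instr.next σ₀ (.load 10 (hdA false) 8)).reg 10 = σ₀.arr (hdA false) v := by
      simp [Instr.next, Instr.value, hσ₀.reg8]
    rw [this]
    exact hσ₀.ready.linked false v
  · have : (nbrs es false v).length ≤ wedgeCost es v := by
      have h := List.length_le_sum_of_one_le
        ((nbrs es false v).map fun u => 1 + min (degree es u) (degree es v)) (by simp)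
      simp only [List.length_map] at h
      unfold wedgeCost
      omega
    simp only [List.map_const', List.sum_replicate, smul_eq_mul]
    omega
  · rintro σ' ⟨h1, h2⟩
    refine ⟨h1, fun z => (h2 z).imp_right fun h => ⟨?_, h.2⟩⟩
    rintro x ⟨-, hx⟩
    exact h.1 hx

/-- Write the registers of the list to the output. -/
def emitAll : List ℕ → Prog
  | [] => .skip
  | r :: rs => .seq (.instr (.emit r)) (emitAll rs)

theorem avoids_emitAll (k : ℕ) (rs : List ℕ) : (emitAll rs).Avoids k := by
  induction rs with
  | nil => trivial
  | cons r rs ih => exact ⟨trivial, ih⟩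

theorem Runs.emitAll {σ : State} (hσ : σ.Bounded W) (rs : List ℕ) :
    Runs W (emitAll rs) (rs.length + 1) σ fun σ' =>
      σ'.arr = σ.arr ∧ σ'.out = σ.out ++ rs.map σ.reg := by
  induction rs generalizing σ with
  | nil => exact Runs.skip (by simp)
  | cons r rs ih =>
    refine Runs.instr_seq _ (hσ.1 _) ((ih (σ := Instr.next σ (.emit r)) hσ).mono le_rfl ?_)
    rintro σ' ⟨h1, h2⟩
    exact ⟨h1, by rw [h2]; simp [Instr.next, Instr.value]⟩

/-- Write the registers of the list to the output, unless `z = v` or `x = u`. -/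
def emitProper (rs : List ℕ) : Prog :=
  .ite (.eq 14 8) .skip (.ite (.eq 15 11) .skip (emitAll rs))

theorem avoids_emitProper (k : ℕ) (rs : List ℕ) : (emitProper rs).Avoids k :=
  ⟨trivial, trivial, avoids_emitAll k rs⟩

theorem Runs.emitProper {es : List (Fin n × Fin n)} {σ : State} {v u z x : Fin n}
    (hσ : Visiting W es v σ) (h11 : σ.reg 11 = u) (h14 : σ.reg 14 = z) (h15 : σ.reg 15 = x)
    {rs : List ℕ} (hrs : rs.length ≤ 7) {c : SmallCycle (Fin n)} (hc : rs.map σ.reg = c.encode) :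
    Runs W (emitProper rs) 10 σ fun σ' => σ'.arr = σ.arr ∧
      σ'.out = σ.out ++ (if z = v ∨ x = u then [] else [c]).flatMap SmallCycle.encode := by
  refine (Runs.ite (T := 9) ?_ ?_).mono le_rfl fun _ h => h
  · intro h
    simp only [Test.Holds, h14, hσ.reg8] at h
    exact (Runs.skip (by simp [Fin.ext h])).mono (by omega) fun _ h => h
  · intro h
    simp only [Test.Holds, h14, hσ.reg8] at h
    refine (Runs.ite (T := 8) ?_ ?_).mono le_rfl fun _ h => h
    · intro h'
      simp only [Test.Holds, h15, h11] at h'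
      exact (Runs.skip (by simp [Fin.ext h'])).mono (by omega) fun _ h => h
    · intro h'
      simp only [Test.Holds, h15, h11] at h'
      refine (Runs.emitAll hσ.bounded rs).mono (by omega) fun σ' hσ' => ⟨hσ'.1, ?_⟩
      rw [hσ'.2, if_neg, hc]
      · simp
      · rintro (rfl | rfl)
        · exact h rfl
        · exact h' rfl

/-! ### The searches around a vertex -/

/-- Search for the bigons at `v`. -/
def bigonSearch : Prog := lookup false false writeSelf (emitAll [4, 8, 11])

/-- Search for the triangles with source (middle vertex) `v` and middle vertex (source) `u`. -/
def triangleSearch (b : Bool) : Prog :=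
  lookup b false writeOut (emitAll (cond b [5, 11, 14, 8] [5, 8, 14, 11]))

/-- Search for quadrangles with source (sink) `v`. -/
def endSearch (b : Bool) : Prog :=
  lookup b b (writeWedges b b) (emitProper (cond b [6, 14, 8, 15, 11] [6, 8, 14, 15, 11]))

/-- Search for quadrangles with middle vertex `v`. -/
def middleSearch (b : Bool) : Prog :=
  lookup b (!b) (writeWedges (!b) b)
    (emitProper (cond b [6, 11, 15, 8, 14] [6, 15, 11, 8, 14]))

theorem lists_bigonSearch (es : List (Fin n × Fin n)) (v : Fin n) :
    Lists W es v bigonSearch (100 * (1 + wedgeCost es v))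
      (Found (IsWedge es false false v) (fun x z => x = v ∧ z = v) fun u _ _ => [.bigon v u]) := by
  have := Lists.lookup (W := W) (b₁ := false) (b₂ := false) (tabulates_writeSelf es v)
    (avoids_emitAll 16 [4, 8, 11]) (fun u _ _ => [.bigon v u]) (by
      intro σ u z x hσ h11 h14 h15
      refine (Runs.emitAll hσ.bounded _).mono (by simp) fun σ' h => ⟨h.1, ?_⟩
      simp [h.2, SmallCycle.encode, hσ.ready.reg4, hσ.reg8, h11])
  exact ⟨this.1, fun σ hσ => (this.2 σ hσ).mono (by omega) fun _ h => h⟩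

theorem lists_triangleSearch (es : List (Fin n × Fin n)) (v : Fin n) (b : Bool) :
    Lists W es v (triangleSearch b) (100 * (1 + wedgeCost es v))
      (Found (IsWedge es b false v) (fun x z => x = z ∧ z ∈ nbrs es false v) fun u z _ =>
        [cond b (.triangle u z v) (.triangle v z u)]) := by
  have := Lists.lookup (W := W) (b₁ := b) (b₂ := false) (tabulates_writeOut es v)
    (avoids_emitAll 16 (cond b [5, 11, 14, 8] [5, 8, 14, 11]))
    (fun u z _ => [cond b (.triangle u z v) (.triangle v z u)]) (by
      intro σ u z x hσ h11 h14 h15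
      refine (Runs.emitAll hσ.bounded _).mono (by cases b <;> simp) fun σ' h => ⟨h.1, ?_⟩
      cases b <;> simp [h.2, SmallCycle.encode, hσ.ready.reg5, hσ.reg8, h11, h14])
  exact ⟨this.1, fun σ hσ => (this.2 σ hσ).mono (by omega) fun _ h => h⟩

theorem lists_endSearch (es : List (Fin n × Fin n)) (v : Fin n) (b : Bool) :
    Lists W es v (endSearch b) (100 * (1 + wedgeCost es v))
      (Found (IsWedge es b b v) (IsWedge es b b v) fun u z x => if z = v ∨ x = u then [] else
        [cond b (.quadrangle z v x u) (.quadrangle v z x u)]) := by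
  have := Lists.lookup (W := W) (b₁ := b) (b₂ := b) (tabulates_writeWedges es v b b)
    (avoids_emitProper 16 (cond b [6, 14, 8, 15, 11] [6, 8, 14, 15, 11]))
    (fun u z x => if z = v ∨ x = u then [] else
        [cond b (.quadrangle z v x u) (.quadrangle v z x u)]) (by
      intro σ u z x hσ h11 h14 h15
      refine Runs.emitProper hσ h11 h14 h15 (by cases b <;> simp) ?_
      cases b <;> simp [SmallCycle.encode, hσ.ready.reg6, hσ.reg8, h11, h14, h15])
  exact ⟨this.1, fun σ hσ => (this.2 σ hσ).mono (by omega) fun _ h => h⟩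

/-- The table records a common neighbour of `v` and `z` on one side, the wedges run over those on
the other. The two values of `b` yield the fixed row and the fixed column. -/
theorem lists_middleSearch (es : List (Fin n × Fin n)) (v : Fin n) (b : Bool) :
    Lists W es v (middleSearch b) (100 * (1 + wedgeCost es v))
      (Found (IsWedge es b (!b) v) (IsWedge es (!b) b v) fun u z x =>
        if z = v ∨ x = u then [] else
          [cond b (.quadrangle u x v z) (.quadrangle x u v z)]) := by
  have := Lists.lookup (W := W) (b₁ := b) (b₂ := !b) (tabulates_writeWedges es v (!b) b)
    (avoids_emitProper 16 (cond b [6, 11, 15, 8, 14] [6, 15, 11, 8, 14]))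
    (fun u z x => if z = v ∨ x = u then [] else
        [cond b (.quadrangle u x v z) (.quadrangle x u v z)]) (by
      intro σ u z x hσ h11 h14 h15
      refine Runs.emitProper hσ h11 h14 h15 (by cases b <;> simp) ?_
      cases b <;> simp [SmallCycle.encode, hσ.ready.reg6, hσ.reg8, h11, h14, h15])
  exact ⟨this.1, fun σ hσ => (this.2 σ hσ).mono (by omega) fun _ h => h⟩

/-- All searches around the vertex in register `8`. -/
def visit : Prog :=
  .seq (.instr (.load 9 8 8)) <| .seq bigonSearch <| .seq (triangleSearch false) <|
    .seq (triangleSearch true) <| .seq (endSearch false) <| .seq (endSearch true) <|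
      .seq (middleSearch false) (middleSearch true)

theorem Runs.visit {G : Digraph (Fin n)} {es : List (Fin n × Fin n)}
    (hes : ∀ u v, (u, v) ∈ es ↔ G.Adj u v) {σ : State} {v : Fin n} (hσ : Ready es σ)
    (hb : σ.Bounded W) (h8 : σ.reg 8 = v) :
    Runs W visit (800 * (1 + wedgeCost es v)) σ fun σ' => σ.Agree 9 σ' ∧ σ'.Bounded W ∧
      ∃ L : List (SmallCycle (Fin n)), σ'.out = σ.out ++ L.flatMap SmallCycle.encode ∧
        (∀ z ∈ L, z.OccursIn G) ∧ CompleteAt G (degree es) L v := by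
  have hag : σ.Agree 9 (Instr.next σ (.load 9 8 8)) := by
    refine ⟨fun r hr => ?_, fun _ _ => rfl⟩
    simp only [Instr.next]
    rw [Function.update_of_ne (by omega)]
  have hb1 : (Instr.next σ (.load 9 8 8)).Bounded W := (Exec.instr _ _ (hb.2 _ _)).bounded hb
  have hvis : Visiting W es v (Instr.next σ (.load 9 8 8)) := by
    refine ⟨hσ.of_agree hag (by omega), hb1, ?_, ?_⟩
    · rw [hag.reg _ (by omega), h8]
    · simp [Instr.next, Instr.value, h8, hσ.deg]
  have hlists := (lists_bigonSearch (W := W) es v).seq <| (lists_triangleSearch es v false).seq <|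
    (lists_triangleSearch es v true).seq <| (lists_endSearch es v false).seq <|
    (lists_endSearch es v true).seq <| (lists_middleSearch es v false).seq
    (lists_middleSearch es v true)
  refine (Runs.instr_seq _ (hb.2 _ _) (((hlists.2 _ hvis).bounded hb1).agree hlists.1)).mono
    (by omega) ?_
  rintro σ' ⟨hag', hb', L, hL, L₁, M₁, rfl, ⟨s1, c1⟩, L₂, M₂, rfl, ⟨s2, c2⟩, L₃, M₃, rfl, ⟨s3, c3⟩,
    L₄, M₄, rfl, ⟨s4, c4⟩, L₅, M₅, rfl, ⟨s5, c5⟩, L₆, L₇, rfl, ⟨s6, c6⟩, ⟨s7, c7⟩⟩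
  refine ⟨hag.trans (hag'.mono (by omega)), hb', _, hL, ?_, ?_⟩
  · simp only [IsWedge, mem_nbrs, hes, cond_true, cond_false, Bool.not_true, Bool.not_false]
      at s1 s2 s3 s4 s5 s6 s7
    intro c hc
    simp only [List.mem_append] at hc
    rcases hc with h | h | h | h | h | h | h
    · obtain ⟨u, z, x, ⟨h1, h2, h3⟩, ⟨h4, rfl⟩, h5⟩ := s1 c h
      rw [List.mem_singleton] at h5
      subst h5
      exact ⟨h1, h3⟩
    · obtain ⟨u, z, x, ⟨h1, h2, h3⟩, ⟨h4, h5⟩, h6⟩ := s2 c h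
      rw [List.mem_singleton] at h6
      subst h6
      exact ⟨h1, h3, h5⟩
    · obtain ⟨u, z, x, ⟨h1, h2, h3⟩, ⟨h4, h5⟩, h6⟩ := s3 c h
      rw [List.mem_singleton] at h6
      subst h6
      exact ⟨h1, h5, h3⟩
    · obtain ⟨u, z, x, ⟨h1, h2, h3⟩, ⟨h4, h5, h6⟩, h7⟩ := s4 c h
      split_ifs at h7 with hne
      · simp at h7
      · rw [List.mem_singleton] at h7
        subst h7
        push Not at hne
        exact ⟨h4, h6, h1, h3, hne.1.symm, hne.2⟩
    · obtain ⟨u, z, x, ⟨h1, h2, h3⟩, ⟨h4, h5, h6⟩, h7⟩ := s5 c h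
      split_ifs at h7 with hne
      · simp at h7
      · rw [List.mem_singleton] at h7
        subst h7
        push Not at hne
        exact ⟨h6, h4, h3, h1, hne.1, hne.2⟩
    · obtain ⟨u, z, x, ⟨h1, h2, h3⟩, ⟨h4, h5, h6⟩, h7⟩ := s6 c h
      split_ifs at h7 with hne
      · simp at h7
      · rw [List.mem_singleton] at h7
        subst h7
        push Not at hne
        exact ⟨h4, h1, h6, h3, hne.2, hne.1.symm⟩
    · obtain ⟨u, z, x, ⟨h1, h2, h3⟩, ⟨h4, h5, h6⟩, h7⟩ := s7 c h
      split_ifs at h7 with hne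
      · simp at h7
      · rw [List.mem_singleton] at h7
        subst h7
        push Not at hne
        exact ⟨h1, h4, h3, h6, hne.2.symm, hne.1.symm⟩
  · simp only [IsWedge, mem_nbrs, hes, cond_true, cond_false, Bool.not_true, Bool.not_false]
      at c1 c2 c3 c4 c5 c6 c7
    refine ⟨?_, ?_, ?_, ?_, ?_, ?_, ?_⟩
    · intro u h1 h2 h3
      obtain ⟨r, hr⟩ := c1 v
      have := (hr u v ⟨h1, h3, h2⟩ ⟨rfl, rfl⟩).2 _ (List.mem_singleton_self _)
      simp [this]
    · intro u w h1 h2 h3 h4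
      obtain ⟨r, hr⟩ := c2 w
      have := (hr u w ⟨h1, h4, h2⟩ ⟨rfl, h3⟩).2 _ (List.mem_singleton_self _)
      simp [this]
    · intro u w h1 h2 h3 h4
      obtain ⟨r, hr⟩ := c3 w
      have := (hr u w ⟨h1, h4, h2⟩ ⟨rfl, h3⟩).2 _ (List.mem_singleton_self _)
      simp [this]
    · intro w
      obtain ⟨r, hr⟩ := c4 w
      refine ⟨r, fun u h1 h2 h3 => ?_⟩
      -- The wedge through `u` was also written to the table, which guarantees an entry at `w`.
      obtain ⟨⟨h4, h5, h6⟩, h7⟩ := hr u u ⟨h1, h3, h2⟩ ⟨h1, h3, h2⟩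
      refine ⟨⟨h4, h6⟩, fun h8 h9 => ?_⟩
      rw [if_neg (by tauto)] at h7
      have := h7 _ (List.mem_singleton_self _)
      simp [this]
    · intro w
      obtain ⟨r, hr⟩ := c5 w
      refine ⟨r, fun u h1 h2 h3 => ?_⟩
      obtain ⟨⟨h4, h5, h6⟩, h7⟩ := hr u u ⟨h1, h3, h2⟩ ⟨h1, h3, h2⟩
      refine ⟨⟨h4, h6⟩, fun h8 h9 => ?_⟩
      rw [if_neg (by tauto)] at h7
      have := h7 _ (List.mem_singleton_self _)
      simp [this]
    · intro z
      obtain ⟨r, hr⟩ := c6 z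
      refine ⟨r, fun u w h1 h2 h3 h4 h5 h6 => ?_⟩
      obtain ⟨⟨k1, k2, k3⟩, h7⟩ := hr w u ⟨h4, h6, h5⟩ ⟨h1, h3, h2⟩
      refine ⟨⟨k1, k3, k2⟩, fun h8 h9 => ?_⟩
      rw [if_neg (by tauto)] at h7
      have := h7 _ (List.mem_singleton_self _)
      simp [this]
    · intro z
      obtain ⟨r, hr⟩ := c7 z
      refine ⟨r, fun u w h1 h2 h3 h4 h5 h6 => ?_⟩
      obtain ⟨⟨k1, k2, k3⟩, h7⟩ := hr u w ⟨h1, h3, h2⟩ ⟨h4, h6, h5⟩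
      refine ⟨⟨k1, k3, k2⟩, fun h8 h9 => ?_⟩
      rw [if_neg (by tauto)] at h7
      have := h7 _ (List.mem_singleton_self _)
      simp [this]

end RAM

namespace RAM

open PathHomology

variable {W n : ℕ}

/-! ### Building the adjacency lists -/

/-- All pointers stay at or below `k`, so writing to the fresh cell `k + 1` does not disturb
existing lists. -/
theorem Linked.congr {nxt nxt' dst dst' : ℕ → ℕ} {k : ℕ} (hle : ∀ j, nxt j ≤ k)
    (hn : ∀ j ≤ k, nxt' j = nxt j) (hd : ∀ j ≤ k, dst' j = dst j) {l : List (Fin n)} {p : ℕ}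
    (hp : p ≤ k) (h : Linked nxt dst p l) : Linked nxt' dst' p l := by
  induction l generalizing p with
  | nil => exact h
  | cons x l ih => exact ⟨h.1, by rw [hd p hp, h.2.1], by rw [hn p hp]; exact ih (hle p) h.2.2⟩

/-- Insert the edge with the index in register `7` into the lists of the side `b`. -/
def insertEdge (b : Bool) : Prog :=
  .seq (.instr (.load 8 b.toNat 7)) <| .seq (.instr (.load 9 (!b).toNat 7)) <|
  .seq (.instr (.add 7 7 3)) <| .seq (.instr (.load 10 (hdA b) 8)) <|
  .seq (.instr (.store (nxtA b) 7 10)) <| .seq (.instr (.store (hdA b) 8 7)) <|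
  .seq (.instr (.store (dstA b) 7 9)) <| .seq (.instr (.load 10 8 8)) <|
  .seq (.instr (.add 10 10 3)) <| .instr (.store 8 8 10)

theorem Runs.insertEdge {b : Bool} {σ : State} (hσ : σ.Bounded W) (h3 : σ.reg 3 = 1)
    (h7 : σ.reg 7 + 1 < W) (h8 : ∀ v, σ.arr 8 v + 1 < W) :
    Runs W (insertEdge b) 10 σ fun σ' =>
      (σ'.reg 7 = σ.reg 7 + 1 ∧ (∀ r < 7, σ'.reg r = σ.reg r) ∧ σ'.out = σ.out) ∧
      σ'.arr (nxtA b) = Function.update (σ.arr (nxtA b)) (σ.reg 7 + 1)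
        (σ.arr (hdA b) (σ.arr b.toNat (σ.reg 7))) ∧
      σ'.arr (hdA b) = Function.update (σ.arr (hdA b)) (σ.arr b.toNat (σ.reg 7)) (σ.reg 7 + 1) ∧
      σ'.arr (dstA b) = Function.update (σ.arr (dstA b)) (σ.reg 7 + 1)
        (σ.arr (!b).toNat (σ.reg 7)) ∧
      σ'.arr 8 = Function.update (σ.arr 8) (σ.arr b.toNat (σ.reg 7))
        (σ.arr 8 (σ.arr b.toNat (σ.reg 7)) + 1) ∧
      ∀ a, a ≠ nxtA b → a ≠ hdA b → a ≠ dstA b → a ≠ 8 → σ'.arr a = σ.arr a := by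
  have hW := hσ.2
  cases b
  all_goals
    refine Runs.instr_seq _ ?_ <| Runs.instr_seq _ ?_ <| Runs.instr_seq _ ?_ <|
      Runs.instr_seq _ ?_ <| Runs.instr_seq _ ?_ <| Runs.instr_seq _ ?_ <| Runs.instr_seq _ ?_ <|
      Runs.instr_seq _ ?_ <| Runs.instr_seq _ ?_ <| Runs.instr _ ?_ ?_
    all_goals
      simp [Instr.next, Instr.value, Function.update_apply, nxtA, hdA, dstA, h3, h7, h8, hW]
  all_goals
    refine ⟨fun r hr => ?_, fun a h₁ h₂ h₃ h₄ => by simp [h₁, h₂, h₃, h₄]⟩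
    split_ifs <;> omega

/-- Build the lists of the side `b`, and count in array `8`. -/
def build (b : Bool) : Prog :=
  .seq (.instr (.const 7 0)) (.loop (.lt 7 1) (insertEdge b))

/-- The arrays which `build b` changes. -/
def Touches (b : Bool) (a : ℕ) : Prop := a = nxtA b ∨ a = hdA b ∨ a = dstA b ∨ a = 8

/-- The edge with index `i` occupies cell `i + 1`, as `0` is the null pointer. Prepending makes the
head of a list point to the latest edge at its vertex. -/
theorem Runs.build {es : List (Fin n × Fin n)} {b : Bool} {σ : State} (hσ : σ.Bounded W)
    (h1 : σ.reg 1 = es.length) (h3 : σ.reg 3 = 1) (hW : es.length + 1 < W)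
    (hdeg : ∀ v, σ.arr 8 v + es.length + 1 < W)
    (hedge : ∀ (b : Bool) i (h : i < es.length),
      σ.arr b.toNat i = (cond b es[i].2 es[i].1 : Fin n))
    (hhd : ∀ v, σ.arr (hdA b) v = 0) (hnxt : ∀ v, σ.arr (nxtA b) v = 0) :
    Runs W (build b) (2 + 11 * es.length) σ fun σ' => σ'.Bounded W ∧
      (∀ r < 7, σ'.reg r = σ.reg r) ∧ (∀ a, ¬ Touches b a → σ'.arr a = σ.arr a) ∧
      σ'.out = σ.out ∧
      (∀ v : Fin n, Linked (σ'.arr (nxtA b)) (σ'.arr (dstA b)) (σ'.arr (hdA b) v) (nbrs es b v)) ∧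
      (∀ v : Fin n, nbrs es b v ≠ [] → ∃ i, ∃ h : i < es.length,
        cond b es[i].2 es[i].1 = v ∧ σ'.arr (hdA b) v = i + 1) ∧
      (∀ v : Fin n, σ'.arr 8 v = σ.arr 8 v + (nbrs es b v).length) ∧
      ∀ v, σ'.arr 8 v ≤ σ.arr 8 v + es.length := by
  have hne : nxtA b ≠ hdA b ∧ nxtA b ≠ dstA b ∧ hdA b ≠ dstA b ∧ nxtA b ≠ 8 ∧ hdA b ≠ 8 ∧
      dstA b ≠ 8 ∧ (∀ c : Bool, ¬ Touches b c.toNat) := by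
    simp only [Touches]
    cases b <;> simp [nxtA, hdA, dstA]
  set I : ℕ → State → Prop := fun k τ => τ.Bounded W ∧ τ.reg 7 = k ∧
      (∀ r < 7, τ.reg r = σ.reg r) ∧ (∀ a, ¬ Touches b a → τ.arr a = σ.arr a) ∧
      τ.out = σ.out ∧ (∀ v, τ.arr (hdA b) v ≤ k) ∧ (∀ j, τ.arr (nxtA b) j ≤ k) ∧
      (∀ v : Fin n,
        Linked (τ.arr (nxtA b)) (τ.arr (dstA b)) (τ.arr (hdA b) v) (nbrs (es.take k) b v)) ∧
      (∀ v : Fin n, nbrs (es.take k) b v ≠ [] → ∃ i, ∃ h : i < es.length,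
        cond b es[i].2 es[i].1 = v ∧ τ.arr (hdA b) v = i + 1) ∧
      (∀ v : Fin n, τ.arr 8 v = σ.arr 8 v + (nbrs (es.take k) b v).length) ∧
      ∀ v, τ.arr 8 v ≤ σ.arr 8 v + k with hI
  have hb0 : (Instr.next σ (.const 7 0)).Bounded W :=
    (Exec.instr (.const 7 0) _ (by simp [Instr.value]; omega)).bounded hσ
  have h0 : I 0 (Instr.next σ (.const 7 0)) := by
    refine ⟨hb0, by simp [Instr.next, Instr.value], ?_, fun _ _ => rfl, rfl, fun v => (hhd v).le,
      fun v => (hnxt v).le, fun v => hhd v, ?_, ?_, fun v => le_rfl⟩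
    · intro r hr
      simp only [Instr.next]
      rw [Function.update_of_ne (by omega)]
    · simp [nbrs]
    · simp [nbrs, Instr.next]
  have hloop := Runs.for_loop (W := W) (p := RAM.insertEdge b) (b := .lt 7 1) (m := es.length) I
    (fun _ => 10) (by
      rintro i τ hi ⟨-, h7, hr, -⟩
      simp [Test.Holds, h7, hr 1 (by omega), h1]) ?_ h0
  · refine (Runs.instr_seq (.const 7 0) (by simp [Instr.value]; omega) hloop).mono (by simp; omega) ?_
    rintro τ ⟨k1, -, k2, k3, k4, -, -, k5, k6, k7, k8⟩
    rw [List.take_length] at k5 k6 k7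
    exact ⟨k1, k2, k3, k4, k5, k6, k7, k8⟩
  rintro i τ hi ⟨k1, k2, k3, k4, k5, k6, k7, k8, k9, k10, k11⟩
  have hsrc : τ.arr b.toNat (τ.reg 7) = (cond b es[i].2 es[i].1 : Fin n) := by
    rw [k2, k4 _ (hne.2.2.2.2.2.2 b), hedge b i hi]
  have hdst : τ.arr (!b).toNat (τ.reg 7) = (cond b es[i].1 es[i].2 : Fin n) := by
    rw [k2, k4 _ (hne.2.2.2.2.2.2 (!b)), hedge (!b) i hi]
    cases b <;> rfl
  refine ((Runs.insertEdge (b := b) k1 (by rw [k3 3 (by omega), h3]) (by omega) (fun v => ?_)).bounded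
    k1).mono le_rfl ?_
  · have := k11 v
    have := hdeg v
    omega
  rw [hsrc, hdst, k2]
  rintro τ' ⟨l1, ⟨l2, l3, l4⟩, l5, l6, l7, l8, l9⟩
  have htake : es.take (i + 1) = es.take i ++ [es[i]] := by
    rw [List.take_append_getElem]
  have hval : ∀ v : Fin n, ((v : ℕ) = (cond b es[i].2 es[i].1 : Fin n)) ↔
      cond b es[i].2 es[i].1 = v := fun v => ⟨fun h => (Fin.ext h).symm, fun h => by rw [h]⟩
  refine ⟨l1, l2, fun r hr => (l3 r hr).trans (k3 r hr), fun a ha => ?_, l4.trans k5, fun v => ?_,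
    fun j => ?_, fun v => ?_, fun v hv => ?_, fun v => ?_, fun v => ?_⟩
  · simp only [Touches, not_or] at ha
    rw [l9 a ha.1 ha.2.1 ha.2.2.1 ha.2.2.2]
    exact k4 a (by simp only [Touches]; tauto)
  · rw [l6, Function.update_apply]
    have := k6 v
    split_ifs <;> omega
  · rw [l5, Function.update_apply]
    have := k7 j
    have := k6 (cond b es[i].2 es[i].1 : Fin n)
    split_ifs <;> omega
  · rw [htake, nbrs_append_singleton, l5, l6, l7, Function.update_apply]
    have hold : ∀ {l : List (Fin n)} {p : ℕ}, p ≤ i →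
        Linked (τ.arr (nxtA b)) (τ.arr (dstA b)) p l → Linked
          (Function.update (τ.arr (nxtA b)) (i + 1)
            (τ.arr (hdA b) (cond b es[i].2 es[i].1 : Fin n)))
          (Function.update (τ.arr (dstA b)) (i + 1) (cond b es[i].1 es[i].2 : Fin n)) p l := by
      intro l p hp
      refine Linked.congr k7 (fun j hj => ?_) (fun j hj => ?_) hp
      · rw [Function.update_of_ne (by omega)]
      · rw [Function.update_of_ne (by omega)]
    simp only [hval]
    split_ifs with h
    · refine ⟨by omega, by rw [Function.update_self], ?_⟩
      rw [Function.update_self]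
      refine hold (k6 _) ?_
      rw [h]
      exact k8 v
    · exact hold (k6 _) (k8 v)
  · rw [l6, Function.update_apply]
    simp only [hval]
    split_ifs with h
    · exact ⟨i, hi, h, rfl⟩
    · refine k9 v fun h' => hv ?_
      rw [htake, nbrs_append_singleton, if_neg h, h']
  · rw [htake, nbrs_append_singleton, l8, Function.update_apply]
    simp only [hval]
    split_ifs with h
    · rw [h, k10 v, List.length_cons]
      omega
    · exact k10 v
  · rw [l8, Function.update_apply]
    have := k11 v
    split_ifs with h
    · rw [← h]
      omega
    · omega

/-! ### The program -/

/-- Visit all vertices with a neighbour on the side `b`. -/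
def visitAll (b : Bool) : Prog :=
  .seq (.instr (.const 7 0)) <| .loop (.lt 7 1) <|
    .seq (.instr (.load 8 b.toNat 7)) <| .seq (.instr (.add 7 7 3)) <|
      .seq (.instr (.load 10 (hdA b) 8)) <| .ite (.eq 10 7) visit .skip

theorem Runs.visitAll {G : Digraph (Fin n)} {es : List (Fin n × Fin n)}
    (hes : ∀ u v, (u, v) ∈ es ↔ G.Adj u v) {b : Bool} {σ : State} (hr : Ready es σ)
    (hσ : σ.Bounded W) (hW : es.length + 1 < W) :
    Runs W (visitAll b) (2 + 806 * es.length + 800 * ∑ v, wedgeCost es v) σ fun σ' =>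
      Ready es σ' ∧ σ'.Bounded W ∧
      ∃ L : List (SmallCycle (Fin n)), σ'.out = σ.out ++ L.flatMap SmallCycle.encode ∧
        (∀ z ∈ L, z.OccursIn G) ∧ ∀ v, nbrs es b v ≠ [] → CompleteAt G (degree es) L v := by
  classical
  let src : Fin es.length → Fin n := fun i => cond b es[i].2 es[i].1
  -- The edges that trigger a visit: those at the head of their list. The head determines `i`, so
  -- `src` is injective on them, and the visit costs sum to at most the total over vertices, with no
  -- term in `n`.
  let hit : Fin es.length → Prop := fun i => σ.arr (hdA b) (src i) = i + 1
  let cost : ℕ → ℕ := fun i => 4 + if h : i < es.length then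
    (if hit ⟨i, h⟩ then 800 * (1 + wedgeCost es (src ⟨i, h⟩)) else 1) else 0
  have hcost : 1 + ∑ i ∈ Finset.range es.length, (cost i + 1) ≤
      1 + 806 * es.length + 800 * ∑ v, wedgeCost es v := by
    have h1 : ∑ i ∈ Finset.range es.length, (cost i + 1) ≤
        ∑ i : Fin es.length, (805 + 800 * if hit i then wedgeCost es (src i) else 0) := by
      rw [Finset.sum_range]
      refine Finset.sum_le_sum fun i _ => ?_
      simp only [cost, dif_pos i.2, Fin.eta]
      split_ifs <;> omega
    have h2 : ∑ i : Fin es.length, (if hit i then wedgeCost es (src i) else 0) ≤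
        ∑ v, wedgeCost es v := by
      rw [← Finset.sum_filter, ← Finset.sum_image (f := wedgeCost es) (g := src)]
      · exact Finset.sum_le_sum_of_subset (Finset.subset_univ _)
      · intro i hi j hj hij
        simp only [Finset.coe_filter, Finset.mem_univ, true_and, Set.mem_ofPred_eq, hit] at hi hj
        rw [hij] at hi
        exact Fin.ext (by omega)
    rw [Finset.sum_add_distrib (f := fun _ : Fin es.length => 805), ← Finset.mul_sum] at h1
    rw [Finset.sum_const, Finset.card_univ, Fintype.card_fin, smul_eq_mul] at h1
    omega
  let I : ℕ → State → Prop := fun k τ => σ.Agree 7 τ ∧ τ.Bounded W ∧ τ.reg 7 = k ∧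
    ∃ L : List (SmallCycle (Fin n)), τ.out = σ.out ++ L.flatMap SmallCycle.encode ∧
      (∀ z ∈ L, z.OccursIn G) ∧ ∀ i : Fin es.length, i < k → hit i →
        CompleteAt G (degree es) L (src i)
  have hag0 : σ.Agree 7 (Instr.next σ (.const 7 0)) := by
    refine ⟨fun r hr => ?_, fun _ _ => rfl⟩
    simp only [Instr.next]
    rw [Function.update_of_ne (by omega)]
  have h0 : I 0 (Instr.next σ (.const 7 0)) := by
    refine ⟨hag0, (Exec.instr (.const 7 0) _ (by simp [Instr.value]; omega)).bounded hσ,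
      by simp [Instr.next, Instr.value], [], by simp [Instr.next], by simp, by simp⟩
  refine (Runs.instr_seq (.const 7 0) (by simp [Instr.value]; omega) (Runs.for_loop
    (m := es.length) I cost ?_ ?_ h0)).mono (by omega) ?_
  · rintro i τ hi ⟨hag, -, h7, -⟩
    simp [Test.Holds, h7, (hr.of_agree hag le_rfl).reg1]
  · rintro i τ hi ⟨hag, hb, h7, L, hL, hocc, hcomp⟩
    have hrτ := hr.of_agree hag le_rfl
    have hv1 : (Instr.add 7 7 3).value (Instr.next τ (.load 8 b.toNat 7)) < W := by
      simp [Instr.value, Instr.next, h7, hrτ.reg3]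
      omega
    have hex1 : Exec W (.instr (.load 8 b.toNat 7)) τ _ 1 := .instr _ _ (hb.2 _ _)
    have hb1 := hex1.bounded hb
    have hex2 := Exec.instr (W := W) (.add 7 7 3) _ hv1
    have hb2 := hex2.bounded hb1
    have hex3 := Exec.instr (W := W) (.load 10 (hdA b) 8) _ (hb2.2 _ _)
    have hb3 := hex3.bounded hb2
    refine (Runs.instr_seq _ (hb.2 _ _) (Runs.instr_seq _ hv1 (Runs.instr_seq (.load 10 (hdA b) 8) (hb2.2 _ _)
      (Runs.ite (T := if hit ⟨i, hi⟩ then 800 * (1 + wedgeCost es (src ⟨i, hi⟩)) else 1)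
        ?_ ?_)))).mono (by simp only [cost, dif_pos hi]; omega) fun _ h => h
    all_goals
      set τ₃ := Instr.next (Instr.next (Instr.next τ (.load 8 b.toNat 7)) (.add 7 7 3))
        (.load 10 (hdA b) 8) with hτ₃
      have hag3 : τ.Agree 7 τ₃ := by
        refine ⟨fun r hr => ?_, fun _ _ => rfl⟩
        simp only [hτ₃, Instr.next]
        rw [Function.update_of_ne (by omega), Function.update_of_ne (by omega),
          Function.update_of_ne (by omega)]
      have h37 : τ₃.reg 7 = i + 1 := by
        simp [hτ₃, Instr.next, Instr.value, h7, hrτ.reg3]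
      have h38 : τ₃.reg 8 = src ⟨i, hi⟩ := by
        simp [hτ₃, Instr.next, Instr.value, h7, hrτ.edge b i hi, src]
      have h310 : τ₃.reg 10 = σ.arr (hdA b) (src ⟨i, hi⟩) := by
        rw [← hag.arr _ (hdA_lt b), ← h38]
        simp [hτ₃, Instr.next, Instr.value]
      have hr3 := hrτ.of_agree hag3 le_rfl
      have ho3 : τ₃.out = τ.out := rfl
      intro htest
      simp only [Test.Holds, h37, h310] at htest
    · rw [if_pos (show hit ⟨i, hi⟩ from htest)]
      refine (Runs.visit hes hr3 hb3 h38).mono le_rfl ?_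
      rintro τ' ⟨hag', hb', L', hL', hocc', hcomp'⟩
      refine ⟨hag.trans (hag3.trans (hag'.mono (by omega))), hb', ?_, L ++ L', ?_, ?_, ?_⟩
      · rw [hag'.reg _ (by omega), h37]
      · rw [hL', ho3, hL]
        simp
      · intro z hz
        rcases List.mem_append.1 hz with h | h
        · exact hocc z h
        · exact hocc' z h
      · intro j hj hhit
        by_cases hji : (j : ℕ) < i
        · exact (hcomp j hji hhit).mono (List.subset_append_left _ _)
        · have : j = ⟨i, hi⟩ := Fin.ext (by simp only; omega)
          subst this
          exact hcomp'.mono (List.subset_append_right _ _)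
    · rw [if_neg (show ¬ hit ⟨i, hi⟩ from htest)]
      refine Runs.skip ⟨hag.trans hag3, hb3, h37, L, hL, hocc, ?_⟩
      intro j hj hhit
      by_cases hji : (j : ℕ) < i
      · exact hcomp j hji hhit
      · have : j = ⟨i, hi⟩ := Fin.ext (by simp only; omega)
        subst this
        exact absurd hhit htest
  · rintro τ ⟨hag, hb, -, L, hL, hocc, hcomp⟩
    refine ⟨hr.of_agree hag le_rfl, hb, L, hL, hocc, fun v hv => ?_⟩
    obtain ⟨i, hi, rfl, h⟩ := hr.head b v hv
    exact hcomp ⟨i, hi⟩ hi h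

/-- Write down generators of the first boundary group. -/
def listCycles : Prog :=
  .seq (.instr (.const 3 1)) <| .seq (.instr (.const 4 2)) <| .seq (.instr (.const 5 3)) <|
    .seq (.instr (.const 6 4)) <| .seq (build false) <| .seq (build true) <|
      .seq (visitAll false) (visitAll true)

/-- Covers the vertices that neither pass visits; every condition there is vacuous. -/
theorem completeAt_of_isolated {G : Digraph (Fin n)} {es : List (Fin n × Fin n)}
    (hes : ∀ u v, (u, v) ∈ es ↔ G.Adj u v) {v : Fin n} (h : ∀ b, nbrs es b v = [])
    (L : List (SmallCycle (Fin n))) : CompleteAt G (degree es) L v := by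
  have h1 : ∀ u, ¬ G.Adj v u := fun u hu => by
    have : u ∈ nbrs es false v := mem_nbrs.2 ((hes v u).2 hu)
    simp [h] at this
  have h2 : ∀ u, ¬ G.Adj u v := fun u hu => by
    have : u ∈ nbrs es true v := mem_nbrs.2 ((hes u v).2 hu)
    simp [h] at this
  exact ⟨fun u h => absurd h (h1 u), fun u _ h => absurd h (h1 u), fun u _ h => absurd h (h2 u),
    fun w => ⟨v, fun u h => absurd h (h1 u)⟩, fun w => ⟨v, fun u h => absurd h (h2 u)⟩,
    fun w => ⟨v, fun u _ h => absurd h (h2 u)⟩, fun w => ⟨v, fun u _ h => absurd h (h2 u)⟩⟩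

theorem Runs.listCycles {G : Digraph (Fin n)} {es : List (Fin n × Fin n)}
    (hes : ∀ u v, (u, v) ∈ es ↔ G.Adj u v) :
    Runs ((n + es.length + 2) ^ 4) listCycles
      (12 + 1634 * es.length + 1600 * ∑ v, wedgeCost es v) (edgeListState es) fun σ' =>
      ∃ L : List (SmallCycle (Fin n)), σ'.out = L.flatMap SmallCycle.encode ∧
        (∀ z ∈ L, z.OccursIn G) ∧ ∀ v, CompleteAt G (degree es) L v := by
  set W := (n + es.length + 2) ^ 4 with hWdef
  set σ₀ : State := edgeListState es with hσ₀
  -- Room for the constants up to 4, the sentinel `n`, the cell indices and the degrees, which are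
  -- at most twice the number of edges.
  have hW : 4 < W ∧ n + 2 * es.length + 1 < W := by
    have h1 : (n + es.length + 2) ^ 4 = (n + es.length + 2) ^ 2 * (n + es.length + 2) ^ 2 := by ring
    have h2 : 2 * (n + es.length + 2) ≤ (n + es.length + 2) ^ 2 := by nlinarith
    have h3 : 4 * (n + es.length + 2) ≤ W := by
      rw [hWdef, h1]
      nlinarith
    omega
  have hedge0 : ∀ (b : Bool) i (h : i < es.length),
      σ₀.arr b.toNat i = (cond b es[i].2 es[i].1 : Fin n) := by
    intro b i h
    cases b <;> simp [hσ₀, edgeListState, h]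
  have hb0 : σ₀.Bounded W := by
    refine ⟨fun r => ?_, fun a i => ?_⟩
    · simp only [hσ₀, edgeListState]
      split_ifs <;> omega
    · by_cases h : i < es.length
      · have h1 := es[i].1.2
        have h2 := es[i].2.2
        simp only [hσ₀, edgeListState]
        split_ifs <;> simp [h] <;> omega
      · simp only [hσ₀, edgeListState]
        split_ifs <;> (try simp [h]) <;> omega
  have v1 : (Instr.const 3 1).value σ₀ < W := by simp [Instr.value]; omega
  have v2 : (Instr.const 4 2).value (Instr.next σ₀ (.const 3 1)) < W := by
    simp [Instr.value]; omega
  have v3 : (Instr.const 5 3).value (Instr.next (Instr.next σ₀ (.const 3 1)) (.const 4 2)) < W := by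
    simp [Instr.value]; omega
  have v4 : (Instr.const 6 4).value
      (Instr.next (Instr.next (Instr.next σ₀ (.const 3 1)) (.const 4 2)) (.const 5 3)) < W := by
    simp [Instr.value]; omega
  have hb1 := (Exec.instr _ _ v4).bounded <| (Exec.instr _ _ v3).bounded <|
    (Exec.instr _ _ v2).bounded <| (Exec.instr _ _ v1).bounded hb0
  refine (Runs.instr_seq _ v1 <| Runs.instr_seq _ v2 <| Runs.instr_seq _ v3 <|
    Runs.instr_seq _ v4 <| Runs.seq (T := 2 + 11 * es.length)
      (T' := 6 + 1623 * es.length + 1600 * ∑ v, wedgeCost es v) ?_).mono (by omega) fun _ h => h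
  set σ₁ := Instr.next (Instr.next (Instr.next (Instr.next σ₀ (.const 3 1)) (.const 4 2))
    (.const 5 3)) (.const 6 4) with hσ₁
  have hregs : σ₁.reg 0 = n ∧ σ₁.reg 1 = es.length ∧ σ₁.reg 2 = 0 ∧ σ₁.reg 3 = 1 ∧ σ₁.reg 4 = 2 ∧
      σ₁.reg 5 = 3 ∧ σ₁.reg 6 = 4 := by
    simp [hσ₁, Instr.next, Instr.value, hσ₀, edgeListState]
  obtain ⟨r0, r1, r2, r3, r4, r5, r6⟩ := hregs
  have harr0 : ∀ a, 2 ≤ a → ∀ v, σ₁.arr a v = 0 := by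
    intro a ha v
    simp only [hσ₁, Instr.next, hσ₀, edgeListState]
    rw [if_neg (by omega), if_neg (by omega)]
  refine (Runs.build hb1 r1 r3 (by omega) (fun v => ?_) hedge0 (harr0 _ (by simp [hdA]))
    (harr0 _ (by simp [nxtA]))).mono le_rfl ?_
  · rw [harr0 8 (by omega)]
    omega
  rintro σ₂ ⟨hb2, hreg2, harr2, hout2, hl2, hh2, hd2, hdle2⟩
  have hT1 : ∀ b : Bool, ∀ c : Bool, ¬ Touches b c.toNat := by
    intro b c
    simp only [Touches]
    cases b <;> cases c <;> simp [nxtA, hdA, dstA]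
  have hT2 : ∀ b : Bool, ¬ Touches b (nxtA !b) ∧ ¬ Touches b (hdA !b) ∧ ¬ Touches b (dstA !b) := by
    intro b
    simp only [Touches]
    cases b <;> simp [nxtA, hdA, dstA]
  refine (Runs.seq (T := 2 + 11 * es.length)
      (T' := 4 + 1612 * es.length + 1600 * ∑ v, wedgeCost es v) ((Runs.build (b := true) hb2
    (by rw [hreg2 _ (by omega), r1]) (by rw [hreg2 _ (by omega), r3]) (by omega) (fun v => ?_)
    (fun b i h => ?_) (fun v => ?_) (fun v => ?_)).mono le_rfl ?_)).mono (by omega) fun _ h => h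
  · have := hdle2 v
    rw [harr0 8 (by omega)] at this
    omega
  · rw [harr2 _ (hT1 _ _)]
    exact hedge0 b i h
  · have := (hT2 false).2.1
    rw [Bool.not_false] at this
    rw [harr2 _ this]
    exact harr0 _ (by simp [hdA]) v
  · have := (hT2 false).1
    rw [Bool.not_false] at this
    rw [harr2 _ this]
    exact harr0 _ (by simp [nxtA]) v
  rintro σ₃ ⟨hb3, hreg3, harr3, hout3, hl3, hh3, hd3, -⟩
  have hT3 := hT2 true
  rw [Bool.not_true] at hT3
  have hr3 : Ready es σ₃ := by
    refine ⟨?_, ?_, ?_, ?_, ?_, ?_, ?_, ?_, ?_, ?_, ?_⟩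
    · rw [hreg3 _ (by omega), hreg2 _ (by omega), r0]
    · rw [hreg3 _ (by omega), hreg2 _ (by omega), r1]
    · rw [hreg3 _ (by omega), hreg2 _ (by omega), r2]
    · rw [hreg3 _ (by omega), hreg2 _ (by omega), r3]
    · rw [hreg3 _ (by omega), hreg2 _ (by omega), r4]
    · rw [hreg3 _ (by omega), hreg2 _ (by omega), r5]
    · rw [hreg3 _ (by omega), hreg2 _ (by omega), r6]
    · intro b i h
      rw [harr3 _ (hT1 _ _), harr2 _ (hT1 _ _)]
      exact hedge0 b i h
    · intro b v
      cases b
      · rw [harr3 _ hT3.1, harr3 _ hT3.2.1, harr3 _ hT3.2.2]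
        exact hl2 v
      · exact hl3 v
    · intro b v
      cases b
      · rw [harr3 _ hT3.2.1]
        exact hh2 v
      · exact hh3 v
    · intro v
      rw [hd3, hd2, harr0 8 (by omega), zero_add, degree]
  have ho3 : σ₃.out = [] := by
    rw [hout3, hout2]
    rfl
  refine (Runs.seq (T' := 2 + 806 * es.length + 800 * ∑ v, wedgeCost es v)
    ((Runs.visitAll (b := false) hes hr3 hb3 (by omega)).mono le_rfl ?_)).mono (by omega)
    fun _ h => h
  rintro σ₄ ⟨hr4, hb4, L, hL, hocc, hcomp⟩
  refine (Runs.visitAll (b := true) hes hr4 hb4 (by omega)).mono le_rfl ?_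
  rintro σ₅ ⟨-, -, L', hL', hocc', hcomp'⟩
  refine ⟨L ++ L', by rw [hL', hL, ho3]; simp, fun z hz => ?_, fun v => ?_⟩
  · rcases List.mem_append.1 hz with h | h
    · exact hocc z h
    · exact hocc' z h
  · by_cases h : nbrs es false v = []
    · by_cases h' : nbrs es true v = []
      · exact completeAt_of_isolated hes (fun b => by cases b <;> assumption) _
      · exact (hcomp' v h').mono (List.subset_append_right _ _)
    · exact (hcomp v h).mono (List.subset_append_left _ _)

/-! ### The running time -/

/-- The lists of one side partition the edges by one of their ends; symmetry of `f` makes the choice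
of the side irrelevant. -/
theorem sum_nbrs (es : List (Fin n × Fin n)) (b : Bool) (f : Fin n → Fin n → ℕ)
    (hf : ∀ u v, f u v = f v u) :
    ∑ v, ((nbrs es b v).map fun u => f u v).sum = (es.map fun e => f e.1 e.2).sum := by
  induction es using List.reverseRecOn with
  | nil => simp [nbrs]
  | append_singleton es e ih =>
    have : ∀ v, ((nbrs (es ++ [e]) b v).map fun u => f u v).sum =
        ((nbrs es b v).map fun u => f u v).sum +
          if cond b e.2 e.1 = v then f (cond b e.1 e.2) v else 0 := by
      intro v
      rw [nbrs_append_singleton]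
      split_ifs
      · simp [add_comm]
      · simp
    simp only [this, Finset.sum_add_distrib, ih, List.map_append, List.sum_append]
    cases b
    · simp [hf e.2 e.1]
    · simp

theorem sum_wedgeCost_le {G : Digraph (Fin n)} (hG : ∀ v, ¬ G.Adj v v)
    {es : List (Fin n × Fin n)} (hnd : es.Nodup) (hes : ∀ u v, (u, v) ∈ es ↔ G.Adj u v) :
    ∑ v, wedgeCost es v ≤
      2 * es.length + 8 * (G.toSimpleGraphInclusive.arboricity * es.length) := by
  have hdeg : ∑ v, degree es v = 2 * es.length := by
    have h := fun b => sum_nbrs es b (fun _ _ => 1) fun _ _ => rfl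
    simp only [List.map_const', List.sum_replicate, smul_eq_mul, mul_one] at h
    simp only [degree, Finset.sum_add_distrib, h]
    omega
  have hmin := Digraph.sum_min_le_arboricity hG es.toFinset
    (fun e he => (hes _ _).1 (List.mem_toFinset.1 he)) (degree es)
  rw [hdeg, List.sum_toFinset _ hnd] at hmin
  have h := fun b => sum_nbrs es b (fun u v => 1 + min (degree es u) (degree es v))
    fun u v => by rw [min_comm]
  simp only [wedgeCost]
  rw [Finset.sum_add_distrib, h, h]
  simp only [List.sum_map_add, List.map_const', List.sum_replicate, smul_eq_mul, mul_one]
  have : 2 * G.toSimpleGraphInclusive.arboricity * (2 * es.length) =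
      4 * (G.toSimpleGraphInclusive.arboricity * es.length) := by ring
  omega

end RAM

/-! ### Assembly of the main theorem -/

theorem PathHomology.SmallCycle.length_le_flatMap_encode {n : ℕ}
    (L : List (PathHomology.SmallCycle (Fin n))) :
    L.length ≤ (L.flatMap PathHomology.SmallCycle.encode).length := by
  induction L with
  | nil => simp
  | cons z L ih =>
    have : 1 ≤ z.encode.length := by cases z <;> simp [encode]
    rw [List.flatMap_cons, List.length_append, List.length_cons]
    omega

theorem theorem3 :
    ∃ (P : RAM.Prog) (c k : ℕ),
      ∀ (n : ℕ) (G : Digraph (Fin n)), (∀ v, ¬ G.Adj v v) →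
      ∀ es : List (Fin n × Fin n), es.Nodup → (∀ u v, (u, v) ∈ es ↔ G.Adj u v) →
      ∃ (L : List (PathHomology.SmallCycle (Fin n))) (σ : RAM.State) (t : ℕ),
        RAM.Exec ((n + es.length + 2) ^ k) P (RAM.edgeListState es) σ t ∧
        t ≤ c * (G.toSimpleGraphInclusive.arboricity * es.length + 1) ∧
        σ.out = L.flatMap PathHomology.SmallCycle.encode ∧
        L.length ≤ c * (G.toSimpleGraphInclusive.arboricity * es.length) ∧
        (∀ z ∈ L, z.OccursIn G) ∧
        (∀ u v, G.Adj u v → G.Adj v u → .bigon u v ∈ L ∨ .bigon v u ∈ L) ∧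
        (∀ u w v, G.Adj u v → G.Adj v w → G.Adj u w → .triangle u w v ∈ L) ∧
        ∀ (F : Type*) [Field F],
          Submodule.span F {x | ∃ z ∈ L, x = z.toChain F} =
            PathHomology.boundaryGroup F G 1 := by
  -- With $m\le a(G)\,m$ the time is at most $12+17634\,a(G)\,m$; the constant has slack.
  refine ⟨RAM.listCycles, 40000, 4, fun n G hG es hnd hes => ?_⟩
  obtain ⟨σ, t, hex, ht, L, hL, hocc, hcomp⟩ := RAM.Runs.listCycles hes
  have hcost := RAM.sum_wedgeCost_le hG hnd hes
  set a := G.toSimpleGraphInclusive.arboricity with ha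
  have hpos : es ≠ [] → es.length ≤ a * es.length := by
    intro h
    obtain ⟨⟨u, v⟩, he⟩ := List.exists_mem_of_ne_nil es h
    have hadj := (hes u v).1 he
    have : 0 < a := SimpleGraph.arboricity_pos (u := u) (v := v)
      ⟨fun h => hG v (h ▸ hadj), Or.inl hadj⟩
    exact Nat.le_mul_of_pos_left _ this
  have hm : es.length ≤ a * es.length := by
    by_cases h : es = []
    · simp [h]
    · exact hpos h
  have hlen : L.length ≤ t := by
    have h1 := PathHomology.SmallCycle.length_le_flatMap_encode L
    have h2 := hex.length_out_le
    rw [← hL] at h1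
    exact h1.trans (by simpa [RAM.edgeListState] using h2)
  refine ⟨L, σ, t, hex, by omega, hL, ?_, hocc, fun u v h1 h2 =>
    PathHomology.bigon_mem_or hcomp h1 h2, fun u w v h1 h2 h3 =>
    PathHomology.triangle_mem hcomp h1 h2 h3, fun F _ =>
    PathHomology.span_eq_boundaryGroup hG hocc hcomp⟩
  -- The length bound has no additive constant: without edges no cycle occurs, and otherwise
  -- $a(G)\,m\ge1$ absorbs it.
  by_cases h : es = []
  · have hL0 : L = [] := by
      rw [List.eq_nil_iff_forall_not_mem]
      intro z hz
      have hno : ∀ u v, ¬ G.Adj u v := fun u v huv => by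
        have := (hes u v).2 huv
        simp [h] at this
      cases z with
      | bigon u v => exact hno _ _ (hocc _ hz).1
      | triangle u w v => exact hno _ _ (hocc _ hz).1
      | quadrangle u w v z => exact hno _ _ (hocc _ hz).1
    simp [hL0]
  · have : 0 < es.length := List.length_pos_iff.2 h
    omega
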